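/- Notation. Let $k,m\ge 0$ be integers, $n=k+m$, and write $[0,1]^n=[0,1]^k\times[0,1]^m$; for $x\in[0,1]^k$ let $P_x=\{x\}\times[0,1]^m$, which is identified with the cube $[0,1]^m$. $\Omega^j([0,1]^n)$ denotes the smooth $j$-forms on the cube, and $\Omega^j([0,1]^n,\partial[0,1]^n)$ those whose restriction (pullback) to every $(n-1)$-dimensional face of the cube is zero. The comass $\|\omega\|_\infty$ is the supremum of $|\omega_y(v_1,\dots,v_j)|$ over points $y\in[0,1]^n$ and unit vectors $v_1,\dots,v_j$. A $j$-current $T$ on $[0,1]^n$ is a linear functional on $\Omega^j([0,1]^n)$; its boundary is $\partial T(\omega)=T(d\omega)$ and its mass is $\operatorname{mass}(T)=\sup\{T(\omega):\|\omega\|_\infty\le 1\}\in[0,\infty]$. A current is supported on $\partial[0,1]^n$ if it vanishes on $\Omega^j([0,1]^n,\partial[0,1]^n)$. The (relative) filling volume of a $j$-current $T$ is $$FV(T)=\inf\{\operatorname{mass}(S): S \text{ a } (j+1)\text{-current on } [0,1]^n \text{ with } \partial S-T \text{ supported on } \partial[0,1]^n\}\in[0,\infty],$$ with $FV(T)=\infty$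 if there is no such $S$ of finite mass; the same definition is used on $[0,1]^m$ with its boundary $\partial[0,1]^m$ (empty if $m=0$). A Lipschitz $k$-chain is a finite real linear combination of Lipschitz maps from the standard $k$-simplex to $[0,1]^n$; it defines a $k$-current by integration of forms. It is a relative cycle in $([0,1]^n,\partial[0,1]^n)$ if its boundary is supported on $\partial[0,1]^n$ (no condition if $k=0$). A random Lipschitz $k$-cycle in $([0,1]^n,\partial[0,1]^n)$ is a map $Z$ from a probability space to the Lipschitz $k$-chains that are relative cycles, such that $\int_Z\omega$ is a random variable for every $\omega\in\Omega^k([0,1]^n)$. The slice $Z\cap P_x$ of a Lipschitz $k$-chain $Z$ is the $0$-current on $P_x\cong[0,1]^m$ $$(Z\cap P_x)(\psi)=\lim_{\rho\to0^+}\frac1{\operatorname{vol}B(x,\rho)}\int_Z \mathbf 1_{B(x,\rho)}(x_1,\dots,x_k)\,\psi(x_{k+1},\dots,x_n)\,dx_1\wedge\dots\wedge dx_k ,$$ which exists for almost every $x$ (set it to $0$ where it does not exist). Theorem. Let $Z$ be a random Lipschitz $k$-cycle in $([0,1]^n,\partial[0,1]^n)$ and let $p:[0,1]^k\to[0,\infty)$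 be an $L^1$ function such that $$\mathbb E\bigl(FV(Z\cap P_x)\bigr)\ge p(x)\qquad\text{for almost every }x\in[0,1]^k .$$ Then $$\mathbb E\bigl(FV(Z)\bigr)\ge\int_{[0,1]^k}p(x)\,dx .$$ -/

import Mathlib

open Set Filter Topology MeasureTheory
open scoped ENNReal NNReal

noncomputable section

namespace CubeCycles

/-- Euclidean space of dimension `n`. -/
abbrev E (n : ℕ) : Type := EuclideanSpace ℝ (Fin n)

/-- The unit cube `[0,1]^n`. -/
def cube (n : ℕ) : Set (E n) := {y | ∀ i, y i ∈ Icc (0 : ℝ) 1}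

lemma isCompact_cube (n : ℕ) : IsCompact (cube n) := by
  have h : cube n = (EuclideanSpace.equiv (Fin n) ℝ).toHomeomorph ⁻¹'
      (Set.univ.pi fun _ => Icc (0 : ℝ) 1) := by
    ext y
    simp only [cube, mem_ofPred_eq, mem_preimage, Set.mem_pi, mem_univ, forall_const]
    rfl
  rw [h, Homeomorph.isCompact_preimage]
  exact isCompact_univ_pi fun _ => isCompact_Icc

/-! ### Differential forms -/

/-- Differential `k`-forms on (subsets of) `ℝ^n`, without any regularity. -/
abbrev RawForm (n k : ℕ) : Type := E n → E n [⋀^Fin k]→L[ℝ] ℝ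

/-- Smooth differential `k`-forms. The smooth forms on the cube are the restrictions of smooth
forms on `ℝ^n`. -/
def Form (n k : ℕ) : Submodule ℝ (RawForm n k) where
  carrier := {α | ContDiff ℝ ((⊤ : ℕ∞) : WithTop ℕ∞) α}
  add_mem' := by
    intro a b ha hb
    rw [mem_ofPred_eq] at *
    exact ha.add hb
  zero_mem' := by
    rw [mem_ofPred_eq]
    exact contDiff_const
  smul_mem' := by
    intro c a ha
    rw [mem_ofPred_eq] at *
    exact ha.const_smul c

lemma contDiff_form {n k : ℕ} (α : Form n k) : ContDiff ℝ ((⊤ : ℕ∞) : WithTop ℕ∞) (α : RawForm n k) := by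
  exact α.2

lemma differentiable_form {n k : ℕ} (α : Form n k) : Differentiable ℝ (α : RawForm n k) :=
  (contDiff_form α).differentiable (by simp)

/-- The exterior derivative `d : Ω^k → Ω^(k+1)`. -/
def d (n k : ℕ) : Form n k →ₗ[ℝ] Form n (k + 1) where
  toFun α := ⟨extDeriv (α : RawForm n k), by
    have h : ContDiff ℝ ((⊤ : ℕ∞) : WithTop ℕ∞) (fderiv ℝ (α : RawForm n k)) :=
      (contDiff_form α).fderiv_right (by simp)
    exact (ContinuousAlternatingMap.alternatizeUncurryFinCLM ℝ (E n) ℝ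
      (n := k)).contDiff.comp h⟩
  map_add' α η := by
    ext1; funext y
    exact extDeriv_add (differentiable_form α y) (differentiable_form η y)
  map_smul' c α := by
    ext1; funext y
    exact extDeriv_smul c (α : RawForm n k)

/-- The comass of a form on the cube: the supremum of `|α_y(v_1, …, v_k)|` over points `y` of the
cube and unit vectors `v_1, …, v_k`, the inner supremum being the operator norm of `α_y`. -/
def comass {n k : ℕ} (α : Form n k) : ℝ≥0∞ := ⨆ y ∈ cube n, ‖(α : RawForm n k) y‖ₑ

/-- The forms in `Ω^k([0,1]^n, ∂[0,1]^n)`: the restriction (pullback) of `α` to each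
`(n-1)`-dimensional face `{y_i = 0}` or `{y_i = 1}` of the cube is zero. -/
def VanishesOnBoundary {n k : ℕ} (α : Form n k) : Prop :=
  ∀ y ∈ cube n, ∀ i : Fin n, (y i = 0 ∨ y i = 1) →
    ∀ v : Fin k → E n, (∀ j, v j i = 0) → (α : RawForm n k) y v = 0

/-! ### Currents -/

/-- `k`-dimensional currents: linear functionals on smooth `k`-forms. Currents of finite mass on
the cube (the only ones that count below) are automatically continuous and depend only on the
restriction of the form to the cube. -/
abbrev Current (n k : ℕ) : Type := Form n k →ₗ[ℝ] ℝ

/-- The boundary of a current, `∂T(α) = T(dα)`. -/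
def boundary {n k : ℕ} (T : Current n (k + 1)) : Current n k := T ∘ₗ d n k

/-- The mass of a current on the cube. -/
def mass {n k : ℕ} (T : Current n k) : ℝ≥0∞ :=
  ⨆ (α : Form n k) (_ : comass α ≤ 1), ENNReal.ofReal (T α)

/-- A current is supported on `∂[0,1]^n` if it is zero on `Ω^k([0,1]^n, ∂[0,1]^n)`. -/
def SupportedOnBoundary {n k : ℕ} (T : Current n k) : Prop :=
  ∀ α : Form n k, VanishesOnBoundary α → T α = 0

/-- `T` is a relative cycle in `([0,1]^n, ∂[0,1]^n)`: its boundary is supported on `∂[0,1]^n`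
(no condition when `k = 0`). -/
def IsRelCycle {n : ℕ} : {k : ℕ} → Current n k → Prop
  | 0, _ => True
  | _ + 1, T => SupportedOnBoundary (boundary T)

/-- `S` fills `T` relative to `∂[0,1]^n`: the current `∂S - T` is supported on `∂[0,1]^n`. -/
def IsRelFilling {n k : ℕ} (S : Current n (k + 1)) (T : Current n k) : Prop :=
  SupportedOnBoundary (boundary S - T)

/-- The (relative) filling volume: the infimum of the masses of the relative fillings; it is `∞`
if there is no filling of finite mass. -/
def FV {n k : ℕ} (T : Current n k) : ℝ≥0∞ :=
  ⨅ (S : Current n (k + 1)) (_ : IsRelFilling S T), mass S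

/-! ### Lipschitz chains -/

/-- The standard `k`-simplex, as `{t ∈ ℝ^k | t_i ≥ 0, ∑ t_i ≤ 1}`. -/
def simplex (k : ℕ) : Set (E k) := {t | (∀ i, 0 ≤ t i) ∧ ∑ i, t i ≤ 1}

lemma convex_simplex (k : ℕ) : Convex ℝ (simplex k) := by
  intro x hx y hy a b ha hb hab
  refine ⟨fun i => ?_, ?_⟩
  · have h1 := hx.1 i
    have h2 := hy.1 i
    simp only [PiLp.add_apply, PiLp.smul_apply, smul_eq_mul]
    positivity
  · simp only [PiLp.add_apply, PiLp.smul_apply, smul_eq_mul, Finset.sum_add_distrib,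
      ← Finset.mul_sum]
    nlinarith [hx.2, hy.2]

lemma isClosed_simplex (k : ℕ) : IsClosed (simplex k) := by
  have h : simplex k = (⋂ i, {t : E k | 0 ≤ t i}) ∩ {t : E k | ∑ i, t i ≤ 1} := by
    ext t; simp [simplex]
  rw [h]
  refine (isClosed_iInter fun i => isClosed_le continuous_const (by fun_prop)).inter
    (isClosed_le (by fun_prop) continuous_const)

lemma simplex_subset_cube (k : ℕ) : simplex k ⊆ cube k := fun _ ht i =>
  ⟨ht.1 i, (Finset.single_le_sum (fun j _ => ht.1 j) (Finset.mem_univ i)).trans ht.2⟩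

lemma volume_simplex_lt_top (k : ℕ) : volume (simplex k) < ∞ :=
  (measure_mono (simplex_subset_cube k)).trans_lt (isCompact_cube k).measure_lt_top

/-- Lipschitz singular `k`-simplices in the cube `[0,1]^n`; the values of the map outside the
simplex are irrelevant. -/
structure LipSimplex (n k : ℕ) where
  toFun : E k → E n
  lipschitz : ∃ C : ℝ≥0, LipschitzOnWith C toFun (simplex k)
  mapsTo : MapsTo toFun (simplex k) (cube n)

/-- The integrand of the pullback of a form along a singular simplex. Lipschitz maps are
differentiable almost everywhere, and almost every point of the simplex is an interior point. -/
def LipSimplex.integrand {n k : ℕ} (σ : LipSimplex n k) (α : RawForm n k) (t : E k) : ℝ :=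
  α (σ.toFun t) fun i => fderiv ℝ σ.toFun t (EuclideanSpace.single i 1)

/-- The integral of a form over a Lipschitz simplex. -/
def LipSimplex.integral {n k : ℕ} (σ : LipSimplex n k) (α : RawForm n k) : ℝ :=
  ∫ t in simplex k, σ.integrand α t

lemma LipSimplex.integrableOn {n k : ℕ} (σ : LipSimplex n k) (α : Form n k) :
    IntegrableOn (σ.integrand α) (simplex k) := by
  obtain ⟨C, hC⟩ := σ.lipschitz
  have hα : Continuous (α : RawForm n k) := (contDiff_form α).continuous
  obtain ⟨M, hM⟩ := (isCompact_cube n).exists_bound_of_continuousOn hα.continuousOn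
  have hmeas : AEStronglyMeasurable (σ.integrand α) (volume.restrict (simplex k)) := by
    have h1 : AEStronglyMeasurable (fun t => (α : RawForm n k) (σ.toFun t))
        (volume.restrict (simplex k)) :=
      (hα.comp_continuousOn hC.continuousOn).aestronglyMeasurable
        (isClosed_simplex k).measurableSet
    have h2 : AEStronglyMeasurable
        (fun t => fun i => fderiv ℝ σ.toFun t (EuclideanSpace.single (i : Fin k) (1 : ℝ)))
        (volume.restrict (simplex k)) := by
      refine (measurable_pi_lambda _ fun i => ?_).aestronglyMeasurable
      exact measurable_fderiv_apply_const ℝ σ.toFun _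
    have h3 : Continuous fun q : (E n [⋀^Fin k]→L[ℝ] ℝ) × (Fin k → E n) => q.1 q.2 :=
      continuous_eval
    exact h3.comp_aestronglyMeasurable (h1.prodMk h2)
  have : IsFiniteMeasure (volume.restrict (simplex k)) :=
    isFiniteMeasure_restrict.2 (volume_simplex_lt_top k).ne
  refine Integrable.of_bound hmeas (M * ∏ _i : Fin k, (C : ℝ)) ?_
  have hfr : ∀ᵐ t ∂(volume.restrict (simplex k)), t ∉ frontier (simplex k) :=
    ae_restrict_of_ae (measure_eq_zero_iff_ae_notMem.1 ((convex_simplex k).addHaar_frontier volume))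
  filter_upwards [hfr, ae_restrict_mem (isClosed_simplex k).measurableSet] with t ht hts
  have hint : simplex k ∈ 𝓝 t := by
    rw [mem_nhds_iff]
    refine ⟨interior (simplex k), interior_subset, isOpen_interior, ?_⟩
    by_contra hcon
    exact ht ⟨subset_closure hts, hcon⟩
  have hM' := hM _ (σ.mapsTo hts)
  refine (ContinuousAlternatingMap.le_opNorm _ _).trans ?_
  refine mul_le_mul hM' ?_ (Finset.prod_nonneg fun _ _ => norm_nonneg _)
    ((norm_nonneg _).trans hM')
  refine Finset.prod_le_prod (fun _ _ => norm_nonneg _) fun i _ => ?_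
  refine (ContinuousLinearMap.le_opNorm _ _).trans ?_
  simpa using norm_fderiv_le_of_lipschitzOn ℝ hint hC

/-- Lipschitz `k`-chains in the cube: finite formal linear combinations of Lipschitz simplices. -/
abbrev LipChain (n k : ℕ) : Type := LipSimplex n k →₀ ℝ

/-- The integral of a form over a Lipschitz chain. -/
def LipChain.integral {n k : ℕ} (Z : LipChain n k) (α : RawForm n k) : ℝ :=
  Z.sum fun σ a => a * σ.integral α

/-- The current `α ↦ ∫_Z α` defined by a Lipschitz chain. -/
def LipChain.toCurrent {n k : ℕ} (Z : LipChain n k) : Current n k where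
  toFun α := LipChain.integral Z α
  map_add' α η := by
    simp only [LipChain.integral, Finsupp.sum, ← Finset.sum_add_distrib, ← mul_add]
    refine Finset.sum_congr rfl fun σ _ => ?_
    congr 1
    exact integral_add (σ.integrableOn α) (σ.integrableOn η)
  map_smul' c α := by
    simp only [LipChain.integral, Finsupp.sum, RingHom.id_apply, smul_eq_mul, Finset.mul_sum]
    refine Finset.sum_congr rfl fun σ _ => ?_
    rw [mul_left_comm]
    congr 1
    exact integral_const_mul c _

/-! ### Slicing by the planes `P_x = {x} × ℝ^m` in `ℝ^(k+m)` -/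

/-- The projection `ℝ^(k+m) → ℝ^k` to the first `k` coordinates. -/
def baseProj (k m : ℕ) : E (k + m) →ₗ[ℝ] E k where
  toFun y := WithLp.toLp 2 fun i => y (Fin.castAdd m i)
  map_add' _ _ := rfl
  map_smul' _ _ := rfl

/-- The projection `ℝ^(k+m) → ℝ^m` to the last `m` coordinates; it identifies every plane
`{x} × [0,1]^m` with the cube `[0,1]^m`. -/
def fiberProj (k m : ℕ) : E (k + m) →ₗ[ℝ] E m where
  toFun y := WithLp.toLp 2 fun i => y (Fin.natAdd k i)
  map_add' _ _ := rfl
  map_smul' _ _ := rfl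

/-- The `k`-covector `dx_1 ∧ ⋯ ∧ dx_k` on `ℝ^(k+m)`. -/
def baseVol (k m : ℕ) : E (k + m) [⋀^Fin k]→L[ℝ] ℝ :=
  { (Matrix.detRowAlternating (R := ℝ) (n := Fin k)).compLinearMap
      ((EuclideanSpace.equiv (Fin k) ℝ).toLinearMap ∘ₗ baseProj k m) with
    cont := by
      change Continuous fun v : Fin k → E (k + m) =>
        Matrix.det (Matrix.of fun i j : Fin k => v i (Fin.castAdd m j))
      fun_prop }

/-- The form `1_B(x_1,…,x_k) ψ(y_1,…,y_m) dx_1 ∧ ⋯ ∧ dx_k` on `ℝ^(k+m)`, for a set `B ⊆ ℝ^k` and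
a function (a `0`-form) `ψ` on `ℝ^m`. -/
def tubeForm {k m : ℕ} (B : Set (E k)) (ψ : Form m 0) : RawForm (k + m) k := fun y =>
  (baseProj k m ⁻¹' B).indicator (fun z => (ψ : RawForm m 0) (fiberProj k m z) 0) y • baseVol k m

/-- The `0`-current `S` on `P_x ≅ ℝ^m` is the slice of the chain `Z` by the plane
`P_x = {x} × ℝ^m`:
`S(ψ) = lim_{ρ → 0+} vol(B(x,ρ))⁻¹ ∫_Z 1_{B(x,ρ)} ψ dx_1 ∧ ⋯ ∧ dx_k` for every smooth `ψ`. -/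
def IsSlice {k m : ℕ} (Z : LipChain (k + m) k) (x : E k) (S : Current m 0) : Prop :=
  ∀ ψ : Form m 0, Tendsto
    (fun ρ : ℝ => (volume.real (Metric.closedBall x ρ))⁻¹ *
      LipChain.integral Z (tubeForm (Metric.closedBall x ρ) ψ))
    (𝓝[>] 0) (𝓝 (S ψ))

lemma IsSlice.unique {k m : ℕ} {Z : LipChain (k + m) k} {x : E k} {S S' : Current m 0}
    (h : IsSlice Z x S) (h' : IsSlice Z x S') : S = S' :=
  LinearMap.ext fun ψ => tendsto_nhds_unique (h ψ) (h' ψ)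

open Classical in
/-- The slice `Z ∩ P_x` as a `0`-current on `P_x ≅ ℝ^m`. It exists for almost every `x`; where it
does not exist it is set to `0`. -/
def slice {k m : ℕ} (Z : LipChain (k + m) k) (x : E k) : Current m 0 :=
  if h : ∃ S, IsSlice Z x S then h.choose else 0

lemma IsSlice.slice_eq {k m : ℕ} {Z : LipChain (k + m) k} {x : E k} {S : Current m 0}
    (h : IsSlice Z x S) : slice Z x = S := by
  have hex : ∃ S, IsSlice Z x S := ⟨S, h⟩
  rw [slice, dif_pos hex]
  exact hex.choose_spec.unique h

/-! ### Random cycles -/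

/-- `Z` is a random Lipschitz relative `k`-cycle in `([0,1]^n, ∂[0,1]^n)`: a random Lipschitz
chain whose integral against every smooth form is a random variable, and which is always a
relative cycle. -/
structure IsRandomLipCycle {Ω : Type*} [MeasurableSpace Ω] {n k : ℕ} (Z : Ω → LipChain n k) :
    Prop where
  measurable : ∀ α : Form n k, Measurable fun s => LipChain.toCurrent (Z s) α
  isRelCycle : ∀ s, IsRelCycle (LipChain.toCurrent (Z s))

end CubeCycles

end

/-!
The theorem reduces to the inequality `∫ FV(Z ∩ P_x) dx ≤ FV(Z)` for a single Lipschitz chain `Z`,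
integrated over the probability space.

By Stokes, a form `α` vanishing on the boundary with `comass (dα) ≤ 1` gives `Z(α) ≤ FV(Z)`
(`ofReal_le_FV`), and by Hahn–Banach such forms compute the filling volume
(`FV_le_of_forall_ofReal_le`). In particular the filling volume of a slice is the supremum of its
values on functions `ψ` on the fibre that vanish on the boundary and satisfy `|dψ| ≤ 1`. Given
finitely many such `ψᵢ` and smooth functions `φᵢ ≥ 0` of the base variables with `∑ φᵢ ≤ 1`, the
form `α = ∑ φᵢ(x) ψᵢ(z) dx₁ ∧ ⋯ ∧ dxₖ` again calibrates: the `dφᵢ` are killed by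
`dx₁ ∧ ⋯ ∧ dxₖ`, and the remaining `∑ φᵢ dψᵢ` is orthogonal to the `dxⱼ`, so Hadamard's
inequality bounds the comass of `dα` by `1` (`comass_d_baseForm_combine_le`).

Paired with `ψ dx₁ ∧ ⋯ ∧ dxₖ`, the chain is a finite signed measure on the base, and by the
Besicovitch differentiation theorem the slice at almost every `x` evaluates `ψ` to the density of
its absolutely continuous part. Letting the `φᵢ` approximate the indicator of the set where the
`i`-th density is the largest, away from the singular parts, bounds the integral of the maximal
density by `FV(Z)` (`lintegral_iSup_rnDeriv_le`, `lintegral_iSup_upperDensity_le_FV`).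

A countable family of `ψ`, dense for uniform convergence, computes the filling volume of every slice
that is continuous for uniform convergence (`FV_slice_le`); for each chain this covers almost every
slice (`ae_upperNorm_lt_top`). The resulting majorant of `FV(Z ∩ P_x)` is jointly measurable in the
random parameter and in `x` (`measurable_tubeAverage`), although neither filling volume is known
to be measurable, and Tonelli's theorem applies to it.
-/

namespace CubeCycles

/-! ### Filling volume as a dual norm -/

/-- The subspace of forms whose pullback to every face of the cube is zero. -/
def relForm (n k : ℕ) : Submodule ℝ (Form n k) where
  carrier := {α | VanishesOnBoundary α}
  add_mem' := by
    intro a b ha hb y hy i hi v hv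
    have h1 := ha y hy i hi v hv
    have h2 := hb y hy i hi v hv
    change (a : RawForm n k) y v + (b : RawForm n k) y v = 0
    rw [h1, h2, add_zero]
  zero_mem' := fun _ _ _ _ _ _ => rfl
  smul_mem' := by
    intro c a ha y hy i hi v hv
    have h1 := ha y hy i hi v hv
    change c * (a : RawForm n k) y v = 0
    rw [h1, mul_zero]

lemma enorm_le_comass {n k : ℕ} (α : Form n k) {y : E n} (hy : y ∈ cube n) :
    ‖(α : RawForm n k) y‖ₑ ≤ comass α :=
  le_iSup₂ (f := fun y (_ : y ∈ cube n) => ‖(α : RawForm n k) y‖ₑ) y hy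

lemma comass_le_iff {n k : ℕ} (α : Form n k) {c : ℝ≥0∞} :
    comass α ≤ c ↔ ∀ y ∈ cube n, ‖(α : RawForm n k) y‖ₑ ≤ c := iSup₂_le_iff

lemma comass_lt_top {n k : ℕ} (α : Form n k) : comass α < ∞ := by
  obtain ⟨M, hM⟩ := (isCompact_cube n).exists_bound_of_continuousOn
    (contDiff_form α).continuous.continuousOn
  refine lt_of_le_of_lt ((comass_le_iff α).2 fun y hy => ?_) (ENNReal.ofReal_lt_top (r := M))
  rw [← ofReal_norm]
  exact ENNReal.ofReal_le_ofReal (hM y hy)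

lemma comass_add_le {n k : ℕ} (α β : Form n k) : comass (α + β) ≤ comass α + comass β :=
  (comass_le_iff _).2 fun _ hy =>
    (enorm_add_le ((α : RawForm n k) _) ((β : RawForm n k) _)).trans
      (add_le_add (enorm_le_comass α hy) (enorm_le_comass β hy))

lemma comass_smul {n k : ℕ} (c : ℝ) (α : Form n k) : comass (c • α) = ‖c‖ₑ * comass α := by
  simp only [comass, ENNReal.mul_iSup]
  refine iSup_congr fun y => iSup_congr fun _ => ?_
  change ‖c • (α : RawForm n k) y‖ₑ = _
  exact enorm_smul _ _

lemma comass_zero {n k : ℕ} : comass (0 : Form n k) = 0 := by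
  simpa using comass_smul (0 : ℝ) (0 : Form n k)

lemma le_mass {n k : ℕ} (T : Current n k) {α : Form n k} (hα : comass α ≤ 1) :
    ENNReal.ofReal (T α) ≤ mass T :=
  le_iSup₂ (f := fun (α : Form n k) (_ : comass α ≤ 1) => ENNReal.ofReal (T α)) α hα

/-- A calibrating form bounds the filling volume from below: this is Stokes' theorem for a
filling. -/
lemma ofReal_le_FV {n k : ℕ} (T : Current n k) {α : Form n k} (hα : VanishesOnBoundary α)
    (hd : comass (d n k α) ≤ 1) : ENNReal.ofReal (T α) ≤ FV T := by
  refine le_iInf₂ fun S hS => ?_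
  have h : S (d n k α) - T α = 0 := hS α hα
  rw [← sub_eq_zero.1 h]
  exact le_mass S hd

lemma FV_zero {n k : ℕ} : FV (0 : Current n k) = 0 := by
  refine le_antisymm (iInf₂_le_of_le 0 ?_ ?_) bot_le
  · intro α _
    simp [boundary]
  · simp [mass]

/-- A linear map has a linear section over its range. The spaces are only assumed to be commutative
monoids, which is the structure carried by submodules of spaces of forms. -/
lemma exists_section_of_range {V W : Type*} [AddCommMonoid V] [Module ℝ V] [AddCommMonoid W]
    [Module ℝ W] (D : V →ₗ[ℝ] W) :
    ∃ g : LinearMap.range D →ₗ[ℝ] V, ∀ w : LinearMap.range D, D (g w) = w := by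
  let := Module.addCommMonoidToAddCommGroup ℝ (M := V)
  let := Module.addCommMonoidToAddCommGroup ℝ (M := W)
  obtain ⟨g, hg⟩ := D.rangeRestrict.exists_rightInverse_of_surjective D.range_rangeRestrict
  exact ⟨g, fun w => congrArg Subtype.val (LinearMap.congr_fun hg w)⟩

/-- Hahn–Banach: calibrating forms detect the whole filling volume. -/
lemma FV_le_of_forall_ofReal_le {n k : ℕ} (T : Current n k) (c : ℝ≥0∞)
    (h : ∀ α : Form n k, VanishesOnBoundary α → comass (d n k α) ≤ 1 →
      ENNReal.ofReal (T α) ≤ c) : FV T ≤ c := by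
  rcases eq_or_ne c ∞ with rfl | hc
  · exact le_top
  -- the bound by `c` on the unit ball, made homogeneous
  have key : ∀ α : Form n k, VanishesOnBoundary α →
      T α ≤ c.toReal * (comass (d n k α)).toReal := by
    intro α hα
    have hfin := (comass_lt_top (d n k α)).ne
    refine le_of_forall_pos_le_add fun ε hε => ?_
    -- `t` is a strict upper bound of the comass of `dα`, so that `t⁻¹ • α` is admissible
    set t : ℝ := (comass (d n k α)).toReal + ε / (c.toReal + 1) with ht
    have hc1 : 0 < c.toReal + 1 := by positivity
    have hε' : 0 < ε / (c.toReal + 1) := by positivity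
    have htpos : 0 < t := by
      have := ENNReal.toReal_nonneg (a := comass (d n k α))
      linarith
    have h1 := h (t⁻¹ • α) ((relForm n k).smul_mem _ hα) (by
      rw [map_smul, comass_smul, ← ENNReal.ofReal_toReal hfin, Real.enorm_of_nonneg (by positivity),
        ← ENNReal.ofReal_mul (by positivity)]
      refine ENNReal.ofReal_le_one.2 ?_
      rw [inv_mul_le_iff₀ htpos]
      linarith)
    rw [map_smul, smul_eq_mul, ENNReal.ofReal_le_iff_le_toReal hc, inv_mul_le_iff₀ htpos] at h1
    have h2 : c.toReal * (ε / (c.toReal + 1)) ≤ ε := by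
      rw [mul_div_assoc', div_le_iff₀ hc1]
      nlinarith
    calc T α ≤ t * c.toReal := h1
      _ = c.toReal * (comass (d n k α)).toReal + c.toReal * (ε / (c.toReal + 1)) := by
        rw [ht]; ring
      _ ≤ _ := by linarith
  have key0 : ∀ α : Form n k, VanishesOnBoundary α → d n k α = 0 → T α = 0 := by
    intro α hα h0
    have h1 := key α hα
    have h2 := key ((-1 : ℝ) • α) ((relForm n k).smul_mem _ hα)
    rw [map_smul, map_smul, h0, smul_zero, comass_zero] at h2
    rw [h0, comass_zero] at h1
    simp only [ENNReal.toReal_zero, mul_zero, smul_eq_mul] at h1 h2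
    linarith
  -- `T` factors through `d` on relative forms; `g` is a linear section of `d`
  let D : relForm n k →ₗ[ℝ] Form n (k + 1) := (d n k).domRestrict (relForm n k)
  obtain ⟨g, hg⟩ := exists_section_of_range D
  have hg' : ∀ w : LinearMap.range D, d n k (g w : Form n k) = w := hg
  let f : Form n (k + 1) →ₗ.[ℝ] ℝ := ⟨LinearMap.range D, T ∘ₗ (relForm n k).subtype ∘ₗ g⟩
  obtain ⟨S, hS1, hS2⟩ := exists_extension_of_le_sublinear f
    (fun α => c.toReal * (comass α).toReal) (fun r hr α => by
      rw [comass_smul, ENNReal.toReal_mul, toReal_enorm, Real.norm_of_nonneg hr.le]; ring)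
    (fun α β => by
      rw [← mul_add, ← ENNReal.toReal_add (comass_lt_top α).ne (comass_lt_top β).ne]
      exact mul_le_mul_of_nonneg_left (ENNReal.toReal_mono
        (ENNReal.add_lt_top.2 ⟨comass_lt_top α, comass_lt_top β⟩).ne (comass_add_le α β))
        ENNReal.toReal_nonneg)
    (fun w => by
      have := key (g w) (g w).2
      rwa [hg'] at this)
  refine iInf₂_le_of_le S ?_ ?_
  · intro α hα
    have h1 : S (d n k α) = T (g ⟨d n k α, ⟨⟨α, hα⟩, rfl⟩⟩) :=
      hS1 ⟨d n k α, ⟨⟨α, hα⟩, rfl⟩⟩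
    have h2 := key0 _ ((relForm n k).add_mem (g ⟨d n k α, ⟨⟨α, hα⟩, rfl⟩⟩).2
      ((relForm n k).smul_mem (-1 : ℝ) hα))
      (by
        rw [map_add, map_smul, hg']
        exact (congrArg _ (neg_one_smul ℝ _)).trans (add_neg_cancel (d n k α)))
    rw [map_add, map_smul, smul_eq_mul] at h2
    change S (d n k α) - T α = 0
    rw [h1]
    linarith
  · refine iSup₂_le fun α hα => ?_
    rw [ENNReal.ofReal_le_iff_le_toReal hc]
    refine (hS2 α).trans ?_
    exact mul_le_of_le_one_right ENNReal.toReal_nonneg (ENNReal.toReal_le_of_le_ofReal zero_le_one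
      (by simpa using hα))

/-! ### The comass of `dψ ∧ dx₁ ∧ ⋯ ∧ dxₖ` -/

/-- Hadamard's inequality. -/
lemma abs_det_le_prod_norm {n : ℕ} (M : Matrix (Fin n) (Fin n) ℝ) :
    |M.det| ≤ ∏ i, ‖WithLp.toLp 2 (M i)‖ := by
  have : Fact (Module.finrank ℝ (EuclideanSpace ℝ (Fin n)) = n) := ⟨by simp⟩
  let b := EuclideanSpace.basisFun (Fin n) ℝ
  have h := b.toBasis.orientation.abs_volumeForm_apply_le fun i => WithLp.toLp 2 (M i)
  rw [b.toBasis.orientation.volumeForm_robust b rfl, Module.Basis.det_apply] at h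
  rw [← Matrix.det_transpose]
  exact h

/-- The value of a `0`-form at a point. -/
abbrev scalar {m : ℕ} (ψ : Form m 0) (z : E m) : ℝ := (ψ : RawForm m 0) z 0

lemma contDiff_scalar {m : ℕ} (ψ : Form m 0) :
    ContDiff ℝ ((⊤ : ℕ∞) : WithTop ℕ∞) (scalar ψ) :=
  (ContinuousAlternatingMap.apply ℝ (E m) ℝ (0 : Fin 0 → E m)).contDiff.comp (contDiff_form ψ)

lemma contDiff_baseProj (k m : ℕ) : ContDiff ℝ ((⊤ : ℕ∞) : WithTop ℕ∞) (baseProj k m) :=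
  (baseProj k m).toContinuousLinearMap.contDiff

lemma contDiff_fiberProj (k m : ℕ) : ContDiff ℝ ((⊤ : ℕ∞) : WithTop ℕ∞) (fiberProj k m) :=
  (fiberProj k m).toContinuousLinearMap.contDiff

lemma continuous_baseProj (k m : ℕ) : Continuous (baseProj k m) :=
  (contDiff_baseProj k m).continuous

lemma fiberProj_mem_cube {k m : ℕ} {y : E (k + m)} (hy : y ∈ cube (k + m)) :
    fiberProj k m y ∈ cube m := fun i => hy (Fin.natAdd k i)

lemma norm_sq_eq_add (k m : ℕ) (y : E (k + m)) :
    ‖y‖ ^ 2 = ‖baseProj k m y‖ ^ 2 + ‖fiberProj k m y‖ ^ 2 := by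
  simp only [EuclideanSpace.norm_sq_eq, Fin.sum_univ_add]
  rfl

lemma norm_fderiv_scalar_le {m : ℕ} {ψ : Form m 0} (h : comass (d m 0 ψ) ≤ 1) {z : E m}
    (hz : z ∈ cube m) : ‖fderiv ℝ (scalar ψ) z‖ ≤ 1 := by
  have h1 : ‖extDeriv (ψ : RawForm m 0) z‖ₑ ≤ 1 := (enorm_le_comass (d m 0 ψ) hz).trans h
  rw [← ofReal_norm, ENNReal.ofReal_le_one] at h1
  refine ContinuousLinearMap.opNorm_le_bound _ zero_le_one fun v => ?_
  have h2 := ContinuousAlternatingMap.le_opNorm (extDeriv (ψ : RawForm m 0) z) fun _ => v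
  rw [extDeriv_apply (differentiable_form ψ z)] at h2
  simp only [Fin.sum_univ_succ, Fin.sum_univ_zero, Finset.prod_const, Finset.card_univ,
    Fintype.card_fin, pow_one, Fin.val_zero, pow_zero, one_smul, add_zero, zero_add] at h2
  refine le_trans (le_of_eq ?_) (h2.trans (mul_le_mul_of_nonneg_right h1 (norm_nonneg v)))
  have h3 : (fun x => (ψ : RawForm m 0) x ((0 : Fin 1).removeNth fun _ => v)) = scalar ψ :=
    funext fun x => congrArg _ (Subsingleton.elim _ _)
  rw [h3]

/-- The form `g dx₁ ∧ ⋯ ∧ dxₖ` on `ℝ^(k+m)`. -/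
noncomputable def baseForm (k m : ℕ) (g : E (k + m) → ℝ)
    (hg : ContDiff ℝ ((⊤ : ℕ∞) : WithTop ℕ∞) g) : Form (k + m) k :=
  ⟨fun y => g y • baseVol k m, hg.smul contDiff_const⟩

lemma baseVol_apply (k m : ℕ) (v : Fin k → E (k + m)) :
    baseVol k m v = Matrix.det (Matrix.of fun i j : Fin k => v i (Fin.castAdd m j)) := rfl

lemma d_baseForm_apply {k m : ℕ} {g : E (k + m) → ℝ}
    (hg : ContDiff ℝ ((⊤ : ℕ∞) : WithTop ℕ∞) g) (y : E (k + m)) (v : Fin (k + 1) → E (k + m)) :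
    (d (k + m) k (baseForm k m g hg) : RawForm (k + m) (k + 1)) y v =
      Matrix.det (Matrix.of fun i : Fin (k + 1) =>
        (Fin.cons (fderiv ℝ g y (v i)) (baseProj k m (v i)).ofLp : Fin (k + 1) → ℝ)) := by
  have hd : DifferentiableAt ℝ g y := hg.differentiable (by simp) y
  change extDeriv (fun y => g y • baseVol k m) y v = _
  rw [extDeriv_apply (hd.smul_const _), Matrix.det_succ_column_zero]
  refine Finset.sum_congr rfl fun i _ => ?_
  have h1 : fderiv ℝ (fun x => (g x • baseVol k m) (i.removeNth v)) y (v i) =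
      fderiv ℝ g y (v i) * baseVol k m (i.removeNth v) := by
    change fderiv ℝ (fun x => g x * baseVol k m (i.removeNth v)) y (v i) = _
    rw [fderiv_mul_const hd]
    simp [mul_comm]
  rw [h1, zsmul_eq_mul, Int.cast_pow, Int.cast_neg, Int.cast_one]
  exact (mul_assoc ((-1 : ℝ) ^ (i : ℕ)) _ _).symm

/-- Differentials of functions of the base variables are killed by `dx₁ ∧ ⋯ ∧ dxₖ`, and the
fibre directions are orthogonal to the base directions, so Hadamard's inequality applies. -/
lemma abs_det_cons_le {k m : ℕ} (L₁ : E k →L[ℝ] ℝ) (L₂ : E m →L[ℝ] ℝ) (hL : ‖L₂‖ ≤ 1)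
    (v : Fin (k + 1) → E (k + m)) :
    |Matrix.det (Matrix.of fun i : Fin (k + 1) =>
        (Fin.cons (L₁ (baseProj k m (v i)) + L₂ (fiberProj k m (v i))) (baseProj k m (v i)).ofLp :
          Fin (k + 1) → ℝ))| ≤ ∏ i, ‖v i‖ := by
  let N : (Fin (k + 1) → ℝ) → Matrix (Fin (k + 1)) (Fin (k + 1)) ℝ := fun a =>
    Matrix.of fun i => (Fin.cons (a i) (baseProj k m (v i)).ofLp : Fin (k + 1) → ℝ)
  have hadd : ∀ a b : Fin (k + 1) → ℝ, (N (fun i => a i + b i)).det = (N a).det + (N b).det := by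
    intro a b
    simp only [Matrix.det_succ_column_zero, ← Finset.sum_add_distrib]
    refine Finset.sum_congr rfl fun i _ => ?_
    change (-1) ^ (i : ℕ) * (a i + b i) * _ = (-1) ^ (i : ℕ) * a i * _ + (-1) ^ (i : ℕ) * b i * _
    rw [mul_add, add_mul]
    rfl
  -- the first column is a linear combination of the others
  have hzero : (N fun i => L₁ (baseProj k m (v i))).det = 0 := by
    refine Matrix.exists_mulVec_eq_zero_iff.1
      ⟨Fin.cons 1 fun j => -L₁ (EuclideanSpace.single j 1), fun h => ?_, ?_⟩
    · exact one_ne_zero (α := ℝ) (by simpa using congrFun h 0)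
    · funext i
      have h1 : L₁ (baseProj k m (v i)) =
          ∑ j, (baseProj k m (v i)).ofLp j * L₁ (EuclideanSpace.single j 1) := by
        conv_lhs => rw [← (EuclideanSpace.basisFun (Fin k) ℝ).sum_repr (baseProj k m (v i))]
        simp
      simp [N, Matrix.mulVec, dotProduct, Fin.sum_univ_succ, h1]
  have hmain := hadd (fun i => L₁ (baseProj k m (v i))) (fun i => L₂ (fiberProj k m (v i)))
  rw [hzero, zero_add] at hmain
  change |(N _).det| ≤ _
  rw [hmain]
  refine (abs_det_le_prod_norm _).trans
    (Finset.prod_le_prod (fun _ _ => norm_nonneg _) fun i _ => ?_)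
  refine le_of_sq_le_sq ?_ (norm_nonneg _)
  rw [norm_sq_eq_add k m, EuclideanSpace.norm_sq_eq, Fin.sum_univ_succ, add_comm,
    EuclideanSpace.norm_sq_eq]
  refine add_le_add le_rfl ?_
  have h1 : ‖L₂ (fiberProj k m (v i))‖ ≤ ‖fiberProj k m (v i)‖ :=
    (L₂.le_opNorm _).trans (mul_le_of_le_one_left (norm_nonneg _) hL)
  exact pow_le_pow_left₀ (norm_nonneg _) h1 2

section Combination

variable {k m : ℕ} {ι : Type*} [Fintype ι]

/-- The function `∑ᵢ φᵢ(x) ψᵢ(z)` on `ℝ^(k+m)`, for functions `φᵢ` of the base variables and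
`0`-forms `ψᵢ` on the fibre. -/
def combine (φ : ι → E k → ℝ) (ψ : ι → Form m 0) (y : E (k + m)) : ℝ :=
  ∑ i, φ i (baseProj k m y) * scalar (ψ i) (fiberProj k m y)

lemma contDiff_combine {φ : ι → E k → ℝ} (hφ : ∀ i, ContDiff ℝ ((⊤ : ℕ∞) : WithTop ℕ∞) (φ i))
    (ψ : ι → Form m 0) : ContDiff ℝ ((⊤ : ℕ∞) : WithTop ℕ∞) (combine φ ψ) :=
  ContDiff.sum fun i _ => ((hφ i).comp (contDiff_baseProj k m)).mul
    ((contDiff_scalar (ψ i)).comp (contDiff_fiberProj k m))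

lemma vanishesOnBoundary_baseForm_combine {φ : ι → E k → ℝ}
    (hφ : ∀ i, ContDiff ℝ ((⊤ : ℕ∞) : WithTop ℕ∞) (φ i)) {ψ : ι → Form m 0}
    (hψ : ∀ i, VanishesOnBoundary (ψ i)) :
    VanishesOnBoundary (baseForm k m (combine φ ψ) (contDiff_combine hφ ψ)) := by
  intro y hy i hi v hv
  change combine φ ψ y * baseVol k m v = 0
  induction i using Fin.addCases with
  | left j =>
    rw [baseVol_apply, Matrix.det_eq_zero_of_column_eq_zero j hv, mul_zero]
  | right j =>
    have h : combine φ ψ y = 0 := Finset.sum_eq_zero fun i _ => by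
      rw [scalar, hψ i _ (fiberProj_mem_cube hy) j hi 0 fun l => l.elim0, mul_zero]
    rw [h, zero_mul]

/-- Differentiating the coefficients `φᵢ` contributes nothing to `d(∑ᵢ φᵢ ψᵢ dx₁ ∧ ⋯ ∧ dxₖ)`, so
its comass is at most that of a convex combination of the `dψᵢ`. -/
lemma comass_d_baseForm_combine_le {φ : ι → E k → ℝ}
    (hφ : ∀ i, ContDiff ℝ ((⊤ : ℕ∞) : WithTop ℕ∞) (φ i)) (hφ0 : ∀ i x, 0 ≤ φ i x)
    (hφ1 : ∀ x, ∑ i, φ i x ≤ 1) {ψ : ι → Form m 0} (hψ : ∀ i, comass (d m 0 (ψ i)) ≤ 1) :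
    comass (d (k + m) k (baseForm k m (combine φ ψ) (contDiff_combine hφ ψ))) ≤ 1 := by
  refine (comass_le_iff _).2 fun y hy => ?_
  rw [← ofReal_norm, ENNReal.ofReal_le_one]
  refine ContinuousAlternatingMap.opNorm_le_bound _ zero_le_one fun v => ?_
  set x := baseProj k m y
  set z := fiberProj k m y
  let L₁ : E k →L[ℝ] ℝ := ∑ i, scalar (ψ i) z • fderiv ℝ (φ i) x
  let L₂ : E m →L[ℝ] ℝ := ∑ i, φ i x • fderiv ℝ (scalar (ψ i)) z
  have hL : ‖L₂‖ ≤ 1 := by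
    refine (norm_sum_le _ _).trans (le_trans (Finset.sum_le_sum fun i _ => ?_) (hφ1 x))
    rw [norm_smul, Real.norm_of_nonneg (hφ0 i x)]
    exact mul_le_of_le_one_right (hφ0 i x) (norm_fderiv_scalar_le (hψ i) (fiberProj_mem_cube hy))
  have hD : HasFDerivAt (combine φ ψ) (∑ i, (φ i x • (fderiv ℝ (scalar (ψ i)) z).comp
      (fiberProj k m).toContinuousLinearMap + scalar (ψ i) z • (fderiv ℝ (φ i) x).comp
      (baseProj k m).toContinuousLinearMap)) y := by
    refine HasFDerivAt.fun_sum fun i _ => ?_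
    have h1 : HasFDerivAt (φ i) (fderiv ℝ (φ i) x) ((baseProj k m).toContinuousLinearMap y) :=
      ((hφ i).differentiable (by simp) x).hasFDerivAt
    have h2 : HasFDerivAt (scalar (ψ i)) (fderiv ℝ (scalar (ψ i)) z)
        ((fiberProj k m).toContinuousLinearMap y) :=
      ((contDiff_scalar (ψ i)).differentiable (by simp) z).hasFDerivAt
    exact (h1.comp y (baseProj k m).toContinuousLinearMap.hasFDerivAt).mul
      (h2.comp y (fiberProj k m).toContinuousLinearMap.hasFDerivAt)
  rw [d_baseForm_apply, hD.fderiv, one_mul, Real.norm_eq_abs]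
  convert abs_det_cons_le L₁ L₂ hL v using 6 with i
  simp only [L₁, L₂, sum_apply, add_apply, smul_apply,
    Finset.sum_add_distrib]
  exact add_comm _ _

end Combination

/-! ### Lipschitz chains as measures -/

namespace LipChain

variable {n k : ℕ}

@[simp] lemma integral_zero (α : RawForm n k) : integral (0 : LipChain n k) α = 0 :=
  Finsupp.sum_zero_index

lemma integral_add (Z Z' : LipChain n k) (α : RawForm n k) :
    integral (Z + Z') α = integral Z α + integral Z' α :=
  Finsupp.sum_add_index' (fun _ => zero_mul _) fun _ _ _ => add_mul _ _ _

lemma integral_single (σ : LipSimplex n k) (a : ℝ) (α : RawForm n k) :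
    integral (Finsupp.single σ a) α = a * σ.integral α :=
  Finsupp.sum_single_index (zero_mul _)

end LipChain

lemma LipSimplex.aemeasurable_comp {n k l : ℕ} (σ : LipSimplex n k) {π : E n → E l}
    (hπ : Continuous π) : AEMeasurable (fun t => π (σ.toFun t)) (volume.restrict (simplex k)) := by
  obtain ⟨C, hC⟩ := σ.lipschitz
  exact (hπ.comp_continuousOn hC.continuousOn).aemeasurable (isClosed_simplex k).measurableSet

/-- Pairing a Lipschitz chain with a fixed smooth form and projecting to `ℝ^l` gives a finite signed
measure, here a difference of two finite measures. -/
lemma exists_measure_integral_eq_sub {n k l : ℕ} (Z : LipChain n k) (α : Form n k) {π : E n → E l}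
    (hπ : Continuous π) : ∃ A B : Measure (E l), IsFiniteMeasure A ∧ IsFiniteMeasure B ∧
      ∀ φ : E l → ℝ, Measurable φ → (∃ C, ∀ x, |φ x| ≤ C) →
        LipChain.integral Z (fun y => φ (π y) • (α : RawForm n k) y) =
          ∫ x, φ x ∂A - ∫ x, φ x ∂B := by
  induction Z using Finsupp.induction_linear with
  | zero => exact ⟨0, 0, inferInstance, inferInstance, by simp⟩
  | add Z Z' h h' =>
    obtain ⟨A, B, hA, hB, h⟩ := h
    obtain ⟨A', B', hA', hB', h'⟩ := h'
    refine ⟨A + A', B + B', inferInstance, inferInstance, fun φ hφ hb => ?_⟩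
    have hint : ∀ μ : Measure (E l), IsFiniteMeasure μ → Integrable φ μ := fun μ _ => by
      obtain ⟨C, hC⟩ := hb
      exact Integrable.of_bound hφ.aestronglyMeasurable C (Eventually.of_forall hC)
    rw [LipChain.integral_add, h φ hφ hb, h' φ hφ hb,
      integral_add_measure (hint A hA) (hint A' hA'),
      integral_add_measure (hint B hB) (hint B' hB')]
    ring
  | single σ a =>
    set ν := volume.restrict (simplex k)
    have hσ : AEMeasurable (fun t => π (σ.toFun t)) ν := σ.aemeasurable_comp hπ
    have hJ : ∀ c : ℝ, Integrable (fun t => c * σ.integrand α t) ν := fun c =>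
      (σ.integrableOn α).const_mul c
    let M : ℝ → Measure (E l) := fun c => (ν.withDensity fun t =>
      ENNReal.ofReal (c * σ.integrand α t)).map fun t => π (σ.toFun t)
    have hM : ∀ c, IsFiniteMeasure (M c) := fun c => by
      have := isFiniteMeasure_withDensity_ofReal (hJ c).2
      exact Measure.isFiniteMeasure_map _ _
    have hMφ : ∀ (c : ℝ) (φ : E l → ℝ), Measurable φ →
        ∫ x, φ x ∂(M c) = ∫ t, max (c * σ.integrand α t) 0 * φ (π (σ.toFun t)) ∂ν := by
      intro c φ hφ
      rw [integral_map (hσ.mono_ac (withDensity_absolutelyContinuous _ _))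
        hφ.aestronglyMeasurable, integral_withDensity_eq_integral_toReal_smul₀
        (hJ c).aestronglyMeasurable.aemeasurable.ennreal_ofReal
        (Eventually.of_forall fun _ => ENNReal.ofReal_lt_top)]
      simp only [ENNReal.toReal_ofReal', smul_eq_mul]
    refine ⟨M a, M (-a), hM a, hM (-a), fun φ hφ ⟨C, hC⟩ => ?_⟩
    have hint : ∀ c, Integrable (fun t => max (c * σ.integrand α t) 0 * φ (π (σ.toFun t))) ν :=
      fun c => (hJ c).pos_part.mul_bdd (c := C) (hφ.comp_aemeasurable hσ).aestronglyMeasurable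
        (Eventually.of_forall fun t => hC _)
    rw [LipChain.integral_single, hMφ a φ hφ, hMφ (-a) φ hφ, ← integral_sub (hint a) (hint (-a)),
      LipSimplex.integral, ← integral_const_mul]
    refine integral_congr_ae (Eventually.of_forall fun t => ?_)
    simp only [LipSimplex.integrand]
    change a * (φ (π (σ.toFun t)) * σ.integrand α t) = max (a * σ.integrand α t) 0 * _ -
      max (-a * σ.integrand α t) 0 * _
    rw [← sub_mul, neg_mul, max_zero_sub_max_neg_zero_eq_self]
    ring

/-- A Lipschitz chain is dominated by a finite measure on the base. -/
lemma exists_measure_abs_integral_le {k m : ℕ} (Z : LipChain (k + m) k) :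
    ∃ κ : Measure (E k), IsFiniteMeasure κ ∧ ∀ (B : Set (E k)) (f : E (k + m) → ℝ) (c : ℝ),
      MeasurableSet B →
      (∀ y ∈ cube (k + m), |f y| ≤ B.indicator (fun _ => c) (baseProj k m y)) →
        |LipChain.integral Z fun y => f y • baseVol k m| ≤ c * κ.real B := by
  induction Z using Finsupp.induction_linear with
  | zero => exact ⟨0, inferInstance, by simp⟩
  | add Z Z' h h' =>
    obtain ⟨κ, hκ, h⟩ := h
    obtain ⟨κ', hκ', h'⟩ := h'
    refine ⟨κ + κ', inferInstance, fun B f c hB hf => ?_⟩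
    rw [LipChain.integral_add, measureReal_add_apply, mul_add]
    exact (abs_add_le _ _).trans (add_le_add (h B f c hB hf) (h' B f c hB hf))
  | single σ a =>
    set ν := volume.restrict (simplex k)
    let α : Form (k + m) k := baseForm k m (fun _ => 1) contDiff_const
    have hσ : AEMeasurable (fun t => baseProj k m (σ.toFun t)) ν :=
      σ.aemeasurable_comp (continuous_baseProj k m)
    have hJ : Integrable (fun t => |a * σ.integrand α t|) ν :=
      ((σ.integrableOn α).const_mul a).abs
    have hfin := isFiniteMeasure_withDensity_ofReal hJ.2
    refine ⟨(ν.withDensity fun t => ENNReal.ofReal |a * σ.integrand α t|).map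
      fun t => baseProj k m (σ.toFun t), Measure.isFiniteMeasure_map _ _, fun B f c hB hf => ?_⟩
    have hg : Measurable (B.indicator fun _ => c) := measurable_const.indicator hB
    have h1 : c * Measure.real (((ν.withDensity fun t => ENNReal.ofReal |a * σ.integrand α t|).map
        fun t => baseProj k m (σ.toFun t))) B =
        ∫ t, |a * σ.integrand α t| * B.indicator (fun _ => c) (baseProj k m (σ.toFun t)) ∂ν := by
      rw [mul_comm, ← smul_eq_mul, ← integral_indicator_const c hB,
        integral_map (hσ.mono_ac (withDensity_absolutelyContinuous _ _))
        hg.aestronglyMeasurable, integral_withDensity_eq_integral_toReal_smul₀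
        hJ.aestronglyMeasurable.aemeasurable.ennreal_ofReal
        (Eventually.of_forall fun _ => ENNReal.ofReal_lt_top)]
      simp only [ENNReal.toReal_ofReal (abs_nonneg _), smul_eq_mul]
    rw [h1, LipChain.integral_single, LipSimplex.integral, ← integral_const_mul, ← Real.norm_eq_abs]
    refine norm_integral_le_of_norm_le (hJ.mul_bdd (c := |c|)
      (hg.comp_aemeasurable hσ).aestronglyMeasurable (Eventually.of_forall fun t => ?_)) ?_
    · by_cases ht : baseProj k m (σ.toFun t) ∈ B <;> simp [ht]
    · filter_upwards [ae_restrict_mem (isClosed_simplex k).measurableSet] with t ht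
      have h2 : σ.integrand α t = baseVol k m fun i =>
          fderiv ℝ σ.toFun t (EuclideanSpace.single i 1) := one_mul _
      rw [h2]
      change ‖a * (f (σ.toFun t) * baseVol k m _)‖ ≤ _
      rw [Real.norm_eq_abs, mul_left_comm, abs_mul, mul_comm]
      exact mul_le_mul_of_nonneg_left (hf _ (σ.mapsTo ht)) (abs_nonneg _)

/-! ### Optimizing over smooth coefficients -/

/-- Up to a set of small measure, the indicators of disjoint measurable sets are the restrictions
of smooth functions that are nonnegative with sum at most `1`: a partition of unity subordinate
to the complements of compact subsets. -/
lemma exists_contDiff_approx_indicator {k : ℕ} {ι : Type*} [Fintype ι] (κ : Measure (E k))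
    [IsFiniteMeasure κ] {S : ι → Set (E k)} (hS : ∀ i, MeasurableSet (S i))
    (hdisj : Pairwise (Function.onFun Disjoint S)) {ε : ℝ} (hε : 0 < ε) :
    ∃ φ : ι → E k → ℝ, (∀ i, ContDiff ℝ ((⊤ : ℕ∞) : WithTop ℕ∞) (φ i)) ∧ (∀ i x, 0 ≤ φ i x) ∧
      (∀ x, ∑ i, φ i x ≤ 1) ∧ ∃ N : Set (E k), MeasurableSet N ∧ κ.real N ≤ ε ∧
        ∀ x ∉ N, ∀ i, φ i x = (S i).indicator 1 x := by
  classical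
  -- the complement of the union is added as a further set
  let S' : Option ι → Set (E k) := fun o => o.elim (⋃ i, S i)ᶜ S
  have hS' : ∀ o, MeasurableSet (S' o) := by
    rintro (_ | i)
    · exact (MeasurableSet.iUnion hS).compl
    · exact hS i
  have hdisj' : Pairwise (Function.onFun Disjoint S') := by
    have h0 : ∀ i, Disjoint (S i) (⋃ i, S i)ᶜ := fun i =>
      disjoint_compl_right_iff_subset.2 (subset_iUnion S i)
    rintro (_ | i) (_ | j) hij
    · exact absurd rfl hij
    · exact (h0 j).symm
    · exact h0 i
    · exact hdisj fun h => hij (congrArg some h)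
  have hcover : ⋃ o, S' o = univ := by
    refine eq_univ_of_forall fun x => ?_
    by_cases hx : x ∈ ⋃ i, S i
    · obtain ⟨i, hi⟩ := mem_iUnion.1 hx
      exact mem_iUnion.2 ⟨some i, hi⟩
    · exact mem_iUnion.2 ⟨none, hx⟩
  set δ : ℝ := ε / (Fintype.card (Option ι)) with hδ
  have hcard : (0 : ℝ) < Fintype.card (Option ι) := by exact_mod_cast Fintype.card_pos
  have hδ0 : 0 < δ := div_pos hε hcard
  choose K hKS hK hKδ using fun o => (hS' o).exists_isCompact_sdiff_lt (measure_ne_top κ _)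
    (ENNReal.ofReal_pos.2 hδ0).ne'
  obtain ⟨f, hf⟩ := SmoothPartitionOfUnity.exists_isSubordinate (modelWithCornersSelf ℝ (E k))
    (isClosed_iUnion_of_finite fun o => (hK o).isClosed)
    (fun o => (⋃ j ∈ ({o}ᶜ : Set (Option ι)), K j)ᶜ)
    (fun o => ((Set.toFinite _).isClosed_biUnion fun j _ => (hK j).isClosed).isOpen_compl)
    (fun x hx => by
      obtain ⟨o, ho⟩ := mem_iUnion.1 hx
      refine mem_iUnion.2 ⟨o, fun h => ?_⟩
      obtain ⟨j, hj, hxj⟩ := mem_iUnion₂.1 h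
      exact disjoint_left.1 (hdisj' hj) (hKS j hxj) (hKS o ho))
  have hsum : ∀ x, ∑ᶠ o, f o x = f none x + ∑ i, f (some i) x := fun x => by
    rw [finsum_eq_sum_of_fintype, Fintype.sum_option]
  -- on `K j` every other function of the partition vanishes
  have hzero : ∀ o j, o ≠ j → ∀ x ∈ K j, f o x = 0 := by
    intro o j hoj x hx
    by_contra h
    have h1 : x ∈ (⋃ j ∈ ({o}ᶜ : Set (Option ι)), K j)ᶜ := hf o (subset_tsupport _ h)
    exact h1 (mem_iUnion₂.2 ⟨j, hoj.symm, hx⟩)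
  refine ⟨fun i => f (some i), fun i => contMDiff_iff_contDiff.1 (f (some i)).contMDiff,
    fun i x => f.nonneg _ x, fun x => ?_, (⋃ o, K o)ᶜ,
    (isClosed_iUnion_of_finite fun o => (hK o).isClosed).measurableSet.compl, ?_, ?_⟩
  · have := f.sum_le_one x
    rw [hsum] at this
    linarith [f.nonneg none x]
  · have hsub : (⋃ o, K o)ᶜ ⊆ ⋃ o, S' o \ K o := by
      intro x hx
      obtain ⟨o, ho⟩ := mem_iUnion.1 (hcover.symm ▸ mem_univ x : x ∈ ⋃ o, S' o)
      exact mem_iUnion.2 ⟨o, ho, fun h => hx (mem_iUnion.2 ⟨o, h⟩)⟩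
    calc κ.real (⋃ o, K o)ᶜ ≤ κ.real (⋃ o, S' o \ K o) := measureReal_mono hsub
      _ ≤ ∑ o, κ.real (S' o \ K o) := measureReal_iUnion_fintype_le _
      _ ≤ ∑ _o : Option ι, δ := Finset.sum_le_sum fun o _ =>
        ENNReal.toReal_le_of_le_ofReal hδ0.le (hKδ o).le
      _ = ε := by
        rw [Finset.sum_const, Finset.card_univ, nsmul_eq_mul, hδ]
        field_simp
  · intro x hx i
    obtain ⟨o, ho⟩ := mem_iUnion.1 (notMem_compl_iff.1 hx)
    by_cases hoi : o = some i
    · subst hoi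
      have h1 := f.sum_eq_one (mem_iUnion.2 ⟨_, ho⟩)
      rw [finsum_eq_sum_of_fintype, Finset.sum_eq_single (some i)
        (fun j _ hj => hzero j _ hj x ho) (by simp)] at h1
      have h2 : x ∈ S i := hKS (some i) ho
      exact h1.trans (indicator_of_mem h2 (1 : E k → ℝ)).symm
    · have h1 : x ∉ S i := fun h => disjoint_left.1 (hdisj' hoi) (hKS o ho) h
      exact (hzero _ o (Ne.symm hoi) x ho).trans (indicator_of_notMem h1 _).symm

/-- A bound on smooth convex combinations of signed measures extends to indicators of disjoint
measurable sets. -/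
lemma sum_measureReal_sub_le {k : ℕ} {ι : Type*} [Fintype ι] (A B : ι → Measure (E k))
    [∀ i, IsFiniteMeasure (A i)] [∀ i, IsFiniteMeasure (B i)] (C : ℝ)
    (h : ∀ φ : ι → E k → ℝ, (∀ i, ContDiff ℝ ((⊤ : ℕ∞) : WithTop ℕ∞) (φ i)) →
      (∀ i x, 0 ≤ φ i x) → (∀ x, ∑ i, φ i x ≤ 1) →
        ∑ i, (∫ x, φ i x ∂(A i) - ∫ x, φ i x ∂(B i)) ≤ C)
    {S : ι → Set (E k)} (hS : ∀ i, MeasurableSet (S i))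
    (hdisj : Pairwise (Function.onFun Disjoint S)) :
    ∑ i, ((A i).real (S i) - (B i).real (S i)) ≤ C := by
  refine le_of_forall_pos_le_add fun ε hε => ?_
  obtain ⟨φ, hφ, hφ0, hφ1, N, hN, hκ, hφN⟩ :=
    exists_contDiff_approx_indicator (∑ i, (A i + B i)) hS hdisj hε
  have hle1 : ∀ i x, φ i x ≤ 1 := fun i x =>
    (Finset.single_le_sum (fun j _ => hφ0 j x) (Finset.mem_univ i)).trans (hφ1 x)
  have hint : ∀ (μ : Measure (E k)) [IsFiniteMeasure μ] i, Integrable (φ i) μ := fun μ _ i =>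
    Integrable.of_bound (hφ i).continuous.aestronglyMeasurable 1
      (Eventually.of_forall fun x => by
        rw [Real.norm_of_nonneg (hφ0 i x)]; exact hle1 i x)
  have hind : ∀ (μ : Measure (E k)) [IsFiniteMeasure μ] (T : Set (E k)), MeasurableSet T →
      Integrable (T.indicator (1 : E k → ℝ)) μ := fun μ _ T hT =>
    (integrable_const (1 : ℝ)).indicator hT
  have habs : ∀ i x, |φ i x - (S i).indicator 1 x| ≤ N.indicator 1 x := by
    intro i x
    by_cases hx : x ∈ N
    · rw [indicator_of_mem hx, Pi.one_apply]
      by_cases hxS : x ∈ S i <;> simp only [hxS, indicator_of_mem, indicator_of_notMem,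
        not_false_eq_true, Pi.one_apply, abs_le] <;> constructor <;> linarith [hφ0 i x, hle1 i x]
    · rw [hφN x hx, sub_self, abs_zero, indicator_of_notMem hx]
  have hmain : ∀ (μ : Measure (E k)) [IsFiniteMeasure μ] i,
      |∫ x, φ i x ∂μ - μ.real (S i)| ≤ μ.real N := by
    intro μ _ i
    rw [← integral_indicator_one (hS i), ← integral_indicator_one hN,
      ← integral_sub (hint μ i) (hind μ _ (hS i))]
    exact (abs_integral_le_integral_abs).trans
      (integral_mono ((hint μ i).sub (hind μ _ (hS i))).abs (hind μ _ hN) (habs i))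
  have hN' : ∑ i, ((A i).real N + (B i).real N) ≤ ε := by
    refine le_trans (le_of_eq ?_) hκ
    simp only [measureReal_def, Measure.coe_finsetSum, Finset.sum_apply, Measure.coe_add,
      Pi.add_apply]
    rw [ENNReal.toReal_sum (fun i _ => by simp)]
    refine Finset.sum_congr rfl fun i _ => ?_
    rw [ENNReal.toReal_add (by simp) (by simp)]
  calc ∑ i, ((A i).real (S i) - (B i).real (S i))
      ≤ ∑ i, ((∫ x, φ i x ∂(A i) - ∫ x, φ i x ∂(B i)) + ((A i).real N + (B i).real N)) := by
        refine Finset.sum_le_sum fun i _ => ?_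
        linarith [(abs_le.1 (hmain (A i) i)).1, (abs_le.1 (hmain (B i) i)).2]
    _ ≤ C + ε := by
      rw [Finset.sum_add_distrib]
      exact add_le_add (h φ hφ hφ0 hφ1) hN'

lemma setIntegral_toReal_rnDeriv_eq_measureReal {X : Type*} [MeasurableSpace X] (μ ν : Measure X)
    [IsFiniteMeasure μ] [SigmaFinite ν] {S : Set X} (hS : μ.singularPart ν S = 0) :
    ∫ x in S, (μ.rnDeriv ν x).toReal ∂ν = μ.real S := by
  rw [Measure.setIntegral_toReal_rnDeriv_eq_withDensity]
  conv_rhs => rw [← Measure.singularPart_add_rnDeriv μ ν]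
  simp [measureReal_def, hS]

/-- A pointwise maximum of densities of signed measures has its integral bounded by what smooth
convex combinations of the measures can achieve: integrate over the sets where a given density is
the largest, away from the singular parts. -/
lemma lintegral_iSup_rnDeriv_le {k N : ℕ} (A B : Fin N → Measure (E k))
    [∀ i, IsFiniteMeasure (A i)] [∀ i, IsFiniteMeasure (B i)] (C : ℝ)
    (h : ∀ φ : Fin N → E k → ℝ, (∀ i, ContDiff ℝ ((⊤ : ℕ∞) : WithTop ℕ∞) (φ i)) →
      (∀ i x, 0 ≤ φ i x) → (∀ x, ∑ i, φ i x ≤ 1) →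
        ∑ i, (∫ x, φ i x ∂(A i) - ∫ x, φ i x ∂(B i)) ≤ C) :
    ∫⁻ x, ⨆ i, ENNReal.ofReal (((A i).rnDeriv volume x).toReal - ((B i).rnDeriv volume x).toReal)
      ≤ ENNReal.ofReal C := by
  set F : Fin N → E k → ℝ := fun i x =>
    ((A i).rnDeriv volume x).toReal - ((B i).rnDeriv volume x).toReal
  have hFm : ∀ i, Measurable (F i) := fun i =>
    (Measure.measurable_rnDeriv _ _).ennreal_toReal.sub
      (Measure.measurable_rnDeriv _ _).ennreal_toReal
  have hFi : ∀ i, Integrable (F i) := fun i =>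
    Measure.integrable_toReal_rnDeriv.sub Measure.integrable_toReal_rnDeriv
  choose a ha ha0 ha1 using fun i => (A i).mutuallySingular_singularPart (volume : Measure (E k))
  choose b hb hb0 hb1 using fun i => (B i).mutuallySingular_singularPart (volume : Measure (E k))
  let R : Set (E k) := (⋂ i, a i) ∩ ⋂ i, b i
  have hR : MeasurableSet R := (MeasurableSet.iInter ha).inter (MeasurableSet.iInter hb)
  have hRae : ∀ᵐ x : E k, x ∈ R := by
    have h1 : ∀ᵐ x : E k, ∀ i, x ∈ a i := ae_all_iff.2 fun i => ha1 i
    have h2 : ∀ᵐ x : E k, ∀ i, x ∈ b i := ae_all_iff.2 fun i => hb1 i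
    filter_upwards [h1, h2] with x hx1 hx2 using ⟨mem_iInter.2 hx1, mem_iInter.2 hx2⟩
  let M : Fin N → Set (E k) := fun i => R ∩ ({x | 0 < F i x} ∩ ⋂ j, {x | F j x ≤ F i x})
  have hM : ∀ i, MeasurableSet (M i) := fun i =>
    hR.inter ((measurableSet_lt measurable_const (hFm i)).inter
      (MeasurableSet.iInter fun j => measurableSet_le (hFm j) (hFm i)))
  -- ties are broken in favour of the smallest index
  let S : Fin N → Set (E k) := fun i => M i \ ⋃ j ∈ Iio i, M j
  have hS : ∀ i, MeasurableSet (S i) := fun i =>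
    (hM i).diff ((Set.toFinite _).measurableSet_biUnion fun j _ => hM j)
  have hlt : ∀ i j, i < j → Disjoint (S i) (S j) := fun i j hij =>
    disjoint_left.2 fun x hi hj => hj.2 (mem_iUnion₂.2 ⟨i, hij, hi.1⟩)
  have hdisj : Pairwise (Function.onFun Disjoint S) := fun i j hij =>
    hij.lt_or_gt.elim (hlt i j) fun h => (hlt j i h).symm
  have hval : ∀ i, ∫ x in S i, F i x = (A i).real (S i) - (B i).real (S i) := by
    intro i
    have hA : (A i).singularPart volume (S i) = 0 :=
      measure_mono_null (fun x hx => mem_iInter.1 hx.1.1.1 i) (ha0 i)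
    have hB : (B i).singularPart volume (S i) = 0 :=
      measure_mono_null (fun x hx => mem_iInter.1 hx.1.1.2 i) (hb0 i)
    rw [← setIntegral_toReal_rnDeriv_eq_measureReal _ _ hA,
      ← setIntegral_toReal_rnDeriv_eq_measureReal _ _ hB,
      ← integral_sub Measure.integrable_toReal_rnDeriv.integrableOn
        Measure.integrable_toReal_rnDeriv.integrableOn]
  have hint : ∀ i, ∫⁻ x in S i, ENNReal.ofReal (F i x) =
      ENNReal.ofReal ((A i).real (S i) - (B i).real (S i)) := by
    intro i
    rw [← hval]
    refine (ofReal_integral_eq_lintegral_ofReal (hFi i).integrableOn ?_).symm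
    filter_upwards [ae_restrict_mem (hS i)] with x hx using le_of_lt hx.1.2.1
  have hnonneg : ∀ i, 0 ≤ (A i).real (S i) - (B i).real (S i) := by
    intro i
    rw [← hval]
    exact setIntegral_nonneg (hS i) fun x hx => le_of_lt hx.1.2.1
  calc ∫⁻ x, ⨆ i, ENNReal.ofReal (F i x)
      ≤ ∫⁻ x, ∑ i, (S i).indicator (fun x => ENNReal.ofReal (F i x)) x := by
        refine lintegral_mono_ae ?_
        filter_upwards [hRae] with x hx
        refine iSup_le fun j => ?_
        rcases le_or_gt (F j x) 0 with hj | hj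
        · rw [ENNReal.ofReal_of_nonpos hj]
          exact bot_le
        · obtain ⟨i₀, -, hi₀⟩ := Finset.exists_max_image Finset.univ (fun i => F i x)
            ⟨j, Finset.mem_univ j⟩
          have hmem : x ∈ M i₀ :=
            ⟨hx, hj.trans_le (hi₀ j (Finset.mem_univ j)),
              mem_iInter.2 fun l => hi₀ l (Finset.mem_univ l)⟩
          obtain ⟨i, hi, hmin⟩ := (Set.toFinite {i | x ∈ M i}).exists_minimal ⟨i₀, hmem⟩
          have hiS : x ∈ S i := ⟨hi, fun hcon => by
            obtain ⟨l, hl, hxl⟩ := mem_iUnion₂.1 hcon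
            exact absurd (hmin hxl (le_of_lt hl)) (not_le.2 hl)⟩
          refine (ENNReal.ofReal_le_ofReal (mem_iInter.1 hi.2.2 j)).trans (le_trans (le_of_eq ?_)
            (Finset.single_le_sum (f := fun i => (S i).indicator
              (fun x => ENNReal.ofReal (F i x)) x) (fun _ _ => bot_le) (Finset.mem_univ i)))
          exact (indicator_of_mem hiS fun x => ENNReal.ofReal (F i x)).symm
    _ = ∑ i, ENNReal.ofReal ((A i).real (S i) - (B i).real (S i)) := by
        rw [lintegral_finsetSum _ fun i _ => (hFm i).ennreal_ofReal.indicator (hS i)]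
        simp only [lintegral_indicator (hS _), hint]
    _ = ENNReal.ofReal (∑ i, ((A i).real (S i) - (B i).real (S i))) :=
        (ENNReal.ofReal_sum_of_nonneg fun i _ => hnonneg i).symm
    _ ≤ ENNReal.ofReal C := ENNReal.ofReal_le_ofReal (sum_measureReal_sub_le A B C h hS hdisj)

/-! ### Averages over small tubes -/

section Tube

variable {k m : ℕ}

/-- The form `φ(x) ψ(z) dx₁ ∧ ⋯ ∧ dxₖ` on `ℝ^(k+m)`. -/
noncomputable def prodForm {φ : E k → ℝ} (hφ : ContDiff ℝ ((⊤ : ℕ∞) : WithTop ℕ∞) φ)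
    (ψ : Form m 0) : Form (k + m) k :=
  baseForm k m (fun y => φ (baseProj k m y) * scalar ψ (fiberProj k m y))
    ((hφ.comp (contDiff_baseProj k m)).mul
      ((contDiff_scalar ψ).comp (contDiff_fiberProj k m)))

lemma prodForm_add_smul {φ : E k → ℝ} (hφ : ContDiff ℝ ((⊤ : ℕ∞) : WithTop ℕ∞) φ)
    (ψ ψ' : Form m 0) (c : ℝ) :
    prodForm hφ (ψ + c • ψ') = prodForm hφ ψ + c • prodForm hφ ψ' := by
  ext1
  funext y
  change (φ _ * (scalar ψ _ + c * scalar ψ' _)) • baseVol k m =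
    (φ _ * scalar ψ _) • baseVol k m + c • ((φ _ * scalar ψ' _) • baseVol k m)
  rw [smul_smul, ← add_smul]
  congr 1
  ring

lemma tubeForm_eq (B : Set (E k)) (ψ : Form m 0) :
    tubeForm B ψ = fun y => (B.indicator 1 (baseProj k m y) * scalar ψ (fiberProj k m y)) •
      baseVol k m := by
  funext y
  unfold tubeForm
  congr 1
  by_cases hy : baseProj k m y ∈ B
  · rw [indicator_of_mem (show y ∈ baseProj k m ⁻¹' B from hy), indicator_of_mem hy,
      Pi.one_apply, one_mul]
  · rw [indicator_of_notMem (show y ∉ baseProj k m ⁻¹' B from hy), indicator_of_notMem hy, zero_mul]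

lemma exists_measure_integral_prod (Z : LipChain (k + m) k) (ψ : Form m 0) :
    ∃ A B : Measure (E k), IsFiniteMeasure A ∧ IsFiniteMeasure B ∧
      ∀ φ : E k → ℝ, Measurable φ → (∃ C, ∀ x, |φ x| ≤ C) →
        LipChain.integral Z (fun y => (φ (baseProj k m y) * scalar ψ (fiberProj k m y)) •
          baseVol k m) = ∫ x, φ x ∂A - ∫ x, φ x ∂B := by
  obtain ⟨A, B, hA, hB, h⟩ := exists_measure_integral_eq_sub Z (baseForm k m
    (fun y => scalar ψ (fiberProj k m y)) ((contDiff_scalar ψ).comp (contDiff_fiberProj k m)))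
    (continuous_baseProj k m)
  refine ⟨A, B, hA, hB, fun φ hφ hb => ?_⟩
  rw [← h φ hφ hb]
  simp only [mul_smul]
  rfl

/-- Smooth functions decreasing to the indicator of the closed ball as `j → ∞`. -/
noncomputable def ballBump (r : ℝ) (j : ℕ) (x x' : E k) : ℝ :=
  Real.smoothTransition (1 + j * (r ^ 2 - ‖x' - x‖ ^ 2))

lemma contDiff_ballBump (r : ℝ) (j : ℕ) (x : E k) :
    ContDiff ℝ ((⊤ : ℕ∞) : WithTop ℕ∞) (ballBump r j x) :=
  Real.smoothTransition.contDiff.comp (contDiff_const.add (contDiff_const.mul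
    (contDiff_const.sub ((contDiff_id.sub contDiff_const).norm_sq ℝ))))

lemma continuous_ballBump_left (r : ℝ) (j : ℕ) (x' : E k) :
    Continuous fun x => ballBump r j x x' :=
  Real.smoothTransition.continuous.comp (by fun_prop)

lemma abs_ballBump_le (r : ℝ) (j : ℕ) (x x' : E k) : |ballBump r j x x'| ≤ 1 := by
  rw [ballBump, abs_of_nonneg (Real.smoothTransition.nonneg _)]
  exact Real.smoothTransition.le_one _

lemma tendsto_ballBump {r : ℝ} (hr : 0 ≤ r) (x x' : E k) :
    Tendsto (fun j => ballBump r j x x') atTop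
      (𝓝 ((Metric.closedBall x r).indicator 1 x')) := by
  by_cases hx : x' ∈ Metric.closedBall x r
  · rw [indicator_of_mem hx]
    refine tendsto_const_nhds.congr fun j => ?_
    rw [mem_closedBall_iff_norm] at hx
    have : ‖x' - x‖ ^ 2 ≤ r ^ 2 := pow_le_pow_left₀ (norm_nonneg _) hx 2
    rw [ballBump, Real.smoothTransition.one_of_one_le, Pi.one_apply]
    have : 0 ≤ (j : ℝ) * (r ^ 2 - ‖x' - x‖ ^ 2) := mul_nonneg j.cast_nonneg (by linarith)
    linarith
  · rw [indicator_of_notMem hx]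
    rw [mem_closedBall_iff_norm, not_le] at hx
    have hlt : r ^ 2 < ‖x' - x‖ ^ 2 := pow_lt_pow_left₀ hx hr two_ne_zero
    obtain ⟨j₀, hj₀⟩ := exists_nat_ge (1 / (‖x' - x‖ ^ 2 - r ^ 2))
    refine tendsto_const_nhds.congr' ?_
    filter_upwards [eventually_ge_atTop j₀] with j hj
    rw [ballBump, Real.smoothTransition.zero_of_nonpos]
    have h1 : 1 / (‖x' - x‖ ^ 2 - r ^ 2) ≤ j := hj₀.trans (by exact_mod_cast hj)
    rw [div_le_iff₀ (by linarith)] at h1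
    linarith

/-- The tube around a plane is a limit of smooth forms, so its integral over a chain is determined
by the current of the chain. -/
lemma tendsto_toCurrent_ballBump (Z : LipChain (k + m) k) (ψ : Form m 0) {r : ℝ} (hr : 0 ≤ r)
    (x : E k) :
    Tendsto (fun j => LipChain.toCurrent Z (prodForm (contDiff_ballBump r j x) ψ)) atTop
      (𝓝 (LipChain.integral Z (tubeForm (Metric.closedBall x r) ψ))) := by
  obtain ⟨A, B, hA, hB, h⟩ := exists_measure_integral_prod Z ψ
  have hconv : ∀ μ : Measure (E k), IsFiniteMeasure μ →
      Tendsto (fun j => ∫ x', ballBump r j x x' ∂μ) atTop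
        (𝓝 (∫ x', (Metric.closedBall x r).indicator 1 x' ∂μ)) := fun μ _ =>
    tendsto_integral_of_dominated_convergence (fun _ => 1)
      (fun j => (contDiff_ballBump r j x).continuous.aestronglyMeasurable) (integrable_const _)
      (fun j => Eventually.of_forall fun x' => abs_ballBump_le r j x x')
      (Eventually.of_forall fun x' => tendsto_ballBump hr x x')
  rw [tubeForm_eq, h _ (measurable_one.indicator Metric.isClosed_closedBall.measurableSet)
    ⟨1, fun x' => by by_cases hx : x' ∈ Metric.closedBall x r <;> simp [hx]⟩]
  refine ((hconv A hA).sub (hconv B hB)).congr fun j => ?_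
  exact (h _ (contDiff_ballBump r j x).continuous.measurable
    ⟨1, fun x' => abs_ballBump_le r j x x'⟩).symm

lemma integral_tubeForm_add_smul (Z : LipChain (k + m) k) (ψ ψ' : Form m 0) (c : ℝ) {r : ℝ}
    (hr : 0 ≤ r) (x : E k) :
    LipChain.integral Z (tubeForm (Metric.closedBall x r) (ψ + c • ψ')) =
      LipChain.integral Z (tubeForm (Metric.closedBall x r) ψ) +
        c * LipChain.integral Z (tubeForm (Metric.closedBall x r) ψ') := by
  refine tendsto_nhds_unique (tendsto_toCurrent_ballBump Z _ hr x)
    (((tendsto_toCurrent_ballBump Z ψ hr x).add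
      ((tendsto_toCurrent_ballBump Z ψ' hr x).const_mul c)).congr fun j => ?_)
  rw [prodForm_add_smul, map_add, map_smul, smul_eq_mul]

/-- The average of a chain over the tube of radius `r` around the plane `P_x`. -/
noncomputable def tubeAverage (Z : LipChain (k + m) k) (r : ℝ) (x : E k) (ψ : Form m 0) : ℝ :=
  (volume.real (Metric.closedBall x r))⁻¹ *
    LipChain.integral Z (tubeForm (Metric.closedBall x r) ψ)

/-- Averages over tubes depend measurably on both the chain and the plane: they are limits of
functions that are measurable in the chain and continuous in the plane. -/
lemma measurable_tubeAverage {Ω : Type*} [MeasurableSpace Ω] {Z : Ω → LipChain (k + m) k}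
    (hZ : ∀ α : Form (k + m) k, Measurable fun s => LipChain.toCurrent (Z s) α) {r : ℝ}
    (hr : 0 ≤ r) (ψ : Form m 0) :
    Measurable fun q : E k × Ω => tubeAverage (Z q.2) r q.1 ψ := by
  have hv : ∀ x : E k, volume.real (Metric.closedBall x r) =
      volume.real (Metric.closedBall (0 : E k) r) := fun x =>
    Measure.addHaar_real_closedBall_center volume x r
  simp only [tubeAverage, hv]
  refine Measurable.const_mul ?_ _
  refine measurable_of_tendsto_metrizable (f := fun (j : ℕ) (q : E k × Ω) =>
    LipChain.toCurrent (Z q.2) (prodForm (contDiff_ballBump r j q.1) ψ)) (fun j => ?_)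
    (tendsto_pi_nhds.2 fun q => tendsto_toCurrent_ballBump (Z q.2) ψ hr q.1)
  refine measurable_uncurry_of_continuous_of_measurable (u := fun (x : E k) (s : Ω) =>
    LipChain.toCurrent (Z s) (prodForm (contDiff_ballBump r j x) ψ)) (fun s => ?_) fun x => hZ _
  obtain ⟨A, B, hA, hB, h⟩ := exists_measure_integral_prod (Z s) ψ
  have hconv : ∀ μ : Measure (E k), IsFiniteMeasure μ →
      Continuous fun x => ∫ x', ballBump r j x x' ∂μ := fun μ _ =>
    continuous_of_dominated (bound := fun _ => 1)
      (fun x => (contDiff_ballBump r j x).continuous.aestronglyMeasurable)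
      (fun x => Eventually.of_forall fun x' => abs_ballBump_le r j x x')
      (integrable_const _) (Eventually.of_forall fun x' => continuous_ballBump_left r j x')
  refine ((hconv A hA).sub (hconv B hB)).congr fun x => ?_
  exact (h _ (contDiff_ballBump r j x).continuous.measurable
    ⟨1, fun x' => abs_ballBump_le r j x x'⟩).symm

/-- Lebesgue differentiation of the signed measure given by a chain and a `0`-form on the fibre. -/
lemma ae_tendsto_tubeAverage (Z : LipChain (k + m) k) (ψ : Form m 0) {A B : Measure (E k)}
    [IsFiniteMeasure A] [IsFiniteMeasure B]
    (h : ∀ φ : E k → ℝ, Measurable φ → (∃ C, ∀ x, |φ x| ≤ C) →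
        LipChain.integral Z (fun y => (φ (baseProj k m y) * scalar ψ (fiberProj k m y)) •
          baseVol k m) = ∫ x, φ x ∂A - ∫ x, φ x ∂B) :
    ∀ᵐ x : E k, Tendsto (fun r => tubeAverage Z r x ψ) (𝓝[>] 0)
      (𝓝 ((A.rnDeriv volume x).toReal - (B.rnDeriv volume x).toReal)) := by
  filter_upwards [Besicovitch.ae_tendsto_rnDeriv A volume, Besicovitch.ae_tendsto_rnDeriv B volume,
    Measure.rnDeriv_lt_top A volume, Measure.rnDeriv_lt_top B volume] with x hA hB hA' hB'
  refine (((ENNReal.tendsto_toReal hA'.ne).comp hA).sub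
    ((ENNReal.tendsto_toReal hB'.ne).comp hB)).congr fun r => ?_
  have hm : MeasurableSet (Metric.closedBall x r) := Metric.isClosed_closedBall.measurableSet
  rw [tubeAverage, tubeForm_eq, h _ (measurable_one.indicator hm)
    ⟨1, fun x' => by by_cases hx : x' ∈ Metric.closedBall x r <;> simp [hx]⟩,
    integral_indicator_one hm, integral_indicator_one hm]
  simp only [Function.comp_apply, ENNReal.toReal_div, measureReal_def]
  ring

lemma IsSlice.tendsto_tubeAverage {Z : LipChain (k + m) k} {x : E k} {T : Current m 0}
    (h : IsSlice Z x T) (ψ : Form m 0) :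
    Tendsto (fun r => tubeAverage Z r x ψ) (𝓝[>] 0) (𝓝 (T ψ)) := h ψ

lemma exists_measure_abs_tubeAverage_le (Z : LipChain (k + m) k) :
    ∃ κ : Measure (E k), IsFiniteMeasure κ ∧ ∀ (r : ℝ) (x : E k) (ψ : Form m 0) (c : ℝ),
      (∀ z ∈ cube m, |scalar ψ z| ≤ c) →
        |tubeAverage Z r x ψ| ≤
          c * (κ.real (Metric.closedBall x r) / volume.real (Metric.closedBall x r)) := by
  obtain ⟨κ, hκ, h⟩ := exists_measure_abs_integral_le Z
  refine ⟨κ, hκ, fun r x ψ c hψ => ?_⟩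
  rw [tubeAverage, abs_mul, abs_of_nonneg (by positivity), mul_div_assoc', div_eq_inv_mul]
  refine mul_le_mul_of_nonneg_left ?_ (by positivity)
  rw [tubeForm_eq]
  refine h _ _ c Metric.isClosed_closedBall.measurableSet fun y hy => ?_
  by_cases hx : baseProj k m y ∈ Metric.closedBall x r
  · simpa only [hx, indicator_of_mem, Pi.one_apply, one_mul] using hψ _ (fiberProj_mem_cube hy)
  · simp only [hx, not_false_eq_true, indicator_of_notMem, zero_mul, abs_zero, le_refl]

end Tube

/-! ### Reduction to countably many test functions -/

/-- Any set of `0`-forms has a countable subset that is dense for uniform convergence on the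
cube. -/
lemma exists_seq_dense_on_cube {m : ℕ} {V : Set (Form m 0)} (hV : V.Nonempty) :
    ∃ u : ℕ → Form m 0, (∀ i, u i ∈ V) ∧ ∀ ψ ∈ V, ∀ ε > 0, ∃ i, ∀ z ∈ cube m,
      |scalar (u i) z - scalar ψ z| ≤ ε := by
  have : CompactSpace (cube m) := isCompact_iff_compactSpace.1 (isCompact_cube m)
  let res : V → C(cube m, ℝ) := fun ψ =>
    ⟨fun z => scalar ψ.1 z, (contDiff_scalar ψ.1).continuous.comp continuous_subtype_val⟩
  let : TopologicalSpace V := TopologicalSpace.induced res inferInstance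
  have : SecondCountableTopology V := TopologicalSpace.secondCountableTopology_induced _ _ res
  have : Nonempty V := hV.to_subtype
  have hres : Continuous res := continuous_induced_dom
  refine ⟨fun i => (TopologicalSpace.denseSeq V i).1, fun i => (TopologicalSpace.denseSeq V i).2,
    fun ψ hψ ε hε => ?_⟩
  obtain ⟨i, hi⟩ := (TopologicalSpace.denseRange_denseSeq V).exists_mem_open
    (Metric.isOpen_ball.preimage hres) ⟨⟨ψ, hψ⟩, Metric.mem_ball_self (x := res ⟨ψ, hψ⟩) hε⟩
  refine ⟨i, fun z hz => ?_⟩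
  exact ((ContinuousMap.dist_apply_le_dist (⟨z, hz⟩ : cube m)).trans (le_of_lt hi) :)

/-! ### The slice inequality for a single chain -/

section Slice

variable {k m : ℕ}

lemma tendsto_one_div_add_nhdsGT : Tendsto (fun n : ℕ => 1 / ((n : ℝ) + 1)) atTop (𝓝[>] 0) :=
  tendsto_nhdsWithin_iff.2 ⟨tendsto_one_div_add_atTop_nhds_zero_nat,
    Eventually.of_forall fun _ => mem_Ioi.2 Nat.one_div_pos_of_nat⟩

/-- The upper density at `x` of the chain `Z`, paired with the `0`-form `ψ` on the fibre; it is the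
positive part of the value of the slice where the slice exists. -/
noncomputable def upperDensity (Z : LipChain (k + m) k) (ψ : Form m 0) (x : E k) : ℝ≥0∞ :=
  limsup (fun n : ℕ => ENNReal.ofReal (tubeAverage Z (1 / ((n : ℝ) + 1)) x ψ)) atTop

lemma upperDensity_eq_of_tendsto {Z : LipChain (k + m) k} {ψ : Form m 0} {x : E k} {t : ℝ}
    (h : Tendsto (fun r => tubeAverage Z r x ψ) (𝓝[>] 0) (𝓝 t)) :
    upperDensity Z ψ x = ENNReal.ofReal t :=
  (ENNReal.tendsto_ofReal (h.comp tendsto_one_div_add_nhdsGT)).limsup_eq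

/-- The upper density at `x` of the chain `Z`, jointly over a sequence of `0`-forms on the fibre. -/
noncomputable def upperNorm (Z : LipChain (k + m) k) (w : ℕ → Form m 0) (x : E k) : ℝ≥0∞ :=
  limsup (fun n : ℕ => ⨆ i, ENNReal.ofReal (tubeAverage Z (1 / ((n : ℝ) + 1)) x (w i))) atTop

/-- The calibrating form `∑ᵢ φᵢ(x) uᵢ(z) dx₁ ∧ ⋯ ∧ dxₖ` evaluated on a chain. -/
lemma sum_integral_le_FV (Z : LipChain (k + m) k) {N : ℕ} {u : Fin N → Form m 0}
    (hu : ∀ i, VanishesOnBoundary (u i) ∧ comass (d m 0 (u i)) ≤ 1) {φ : Fin N → E k → ℝ}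
    (hφ : ∀ i, ContDiff ℝ ((⊤ : ℕ∞) : WithTop ℕ∞) (φ i)) (hφ0 : ∀ i x, 0 ≤ φ i x)
    (hφ1 : ∀ x, ∑ i, φ i x ≤ 1) :
    ENNReal.ofReal (∑ i, LipChain.integral Z fun y =>
      (φ i (baseProj k m y) * scalar (u i) (fiberProj k m y)) • baseVol k m) ≤
        FV (LipChain.toCurrent Z) := by
  have h : baseForm k m (combine φ u) (contDiff_combine hφ u) = ∑ i, prodForm (hφ i) (u i) := by
    ext1
    rw [AddSubmonoidClass.coe_finsetSum]
    funext y
    rw [Finset.sum_apply]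
    exact Finset.sum_smul
  have h1 := ofReal_le_FV (LipChain.toCurrent Z)
    (vanishesOnBoundary_baseForm_combine hφ fun i => (hu i).1)
    (comass_d_baseForm_combine_le hφ hφ0 hφ1 fun i => (hu i).2)
  rw [h, map_sum] at h1
  exact h1

/-- The integral over the base of the largest density of a sequence of calibrating functions on
the fibres is at most the filling volume. -/
lemma lintegral_iSup_upperDensity_le_FV (Z : LipChain (k + m) k) {u : ℕ → Form m 0}
    (hu : ∀ i, VanishesOnBoundary (u i) ∧ comass (d m 0 (u i)) ≤ 1) :
    ∫⁻ x, ⨆ i, upperDensity Z (u i) x ≤ FV (LipChain.toCurrent Z) := by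
  rcases eq_or_ne (FV (LipChain.toCurrent Z)) ∞ with hF | hF
  · rw [hF]; exact le_top
  choose A B hA hB h using fun i => exists_measure_integral_prod Z (u i)
  let g : ℕ → E k → ℝ≥0∞ := fun i x =>
    ENNReal.ofReal (((A i).rnDeriv volume x).toReal - ((B i).rnDeriv volume x).toReal)
  have hg : ∀ i, Measurable (g i) := fun i =>
    ((Measure.measurable_rnDeriv _ _).ennreal_toReal.sub
      (Measure.measurable_rnDeriv _ _).ennreal_toReal).ennreal_ofReal
  have hae : ∀ᵐ x : E k, ∀ i, upperDensity Z (u i) x = g i x := by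
    refine ae_all_iff.2 fun i => ?_
    filter_upwards [ae_tendsto_tubeAverage Z (u i) (h i)] with x hx
      using upperDensity_eq_of_tendsto hx
  have hsup : ∀ x, ⨆ i, g i x = ⨆ N, ⨆ i : Fin N, g i x := fun x =>
    le_antisymm (iSup_le fun i => le_iSup_of_le (i + 1)
        (le_iSup (fun j : Fin (i + 1) => g j x) (Fin.last i)))
      (iSup_le fun N => iSup_le fun i => le_iSup (fun i => g i x) i)
  calc ∫⁻ x, ⨆ i, upperDensity Z (u i) x = ∫⁻ x, ⨆ N, ⨆ i : Fin N, g i x := by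
        refine lintegral_congr_ae ?_
        filter_upwards [hae] with x hx
        rw [← hsup]
        exact iSup_congr hx
    _ = ⨆ N, ∫⁻ x, ⨆ i : Fin N, g i x := by
        refine lintegral_iSup (fun N => Measurable.iSup fun i : Fin N => hg i) fun N N' hN x => ?_
        exact iSup_le fun i => le_iSup (fun j : Fin N' => g j x) (Fin.castLE hN i)
    _ ≤ FV (LipChain.toCurrent Z) := by
        refine iSup_le fun N => ?_
        rw [← ENNReal.ofReal_toReal hF]
        refine lintegral_iSup_rnDeriv_le (fun i : Fin N => A i) (fun i => B i) _
          fun φ hφ hφ0 hφ1 => ?_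
        have h1 := sum_integral_le_FV Z (u := fun i : Fin N => u i) (fun i => hu i) hφ hφ0 hφ1
        rw [ENNReal.ofReal_le_iff_le_toReal hF] at h1
        refine le_trans (le_of_eq (Finset.sum_congr rfl fun i _ => ?_)) h1
        refine (h i (φ i) (hφ i).continuous.measurable ⟨1, fun x => ?_⟩).symm
        rw [abs_of_nonneg (hφ0 i x)]
        exact (Finset.single_le_sum (fun j _ => hφ0 j x) (Finset.mem_univ i)).trans (hφ1 x)

/-- The upper norm is at most the density of a finite measure dominating the chain. -/
lemma ae_upperNorm_lt_top (Z : LipChain (k + m) k) {w : ℕ → Form m 0}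
    (hw : ∀ i, ∀ z ∈ cube m, |scalar (w i) z| ≤ 1) : ∀ᵐ x : E k, upperNorm Z w x < ∞ := by
  obtain ⟨κ, hκ, h⟩ := exists_measure_abs_tubeAverage_le Z
  filter_upwards [Besicovitch.ae_tendsto_rnDeriv κ volume, Measure.rnDeriv_lt_top κ volume]
    with x hx hx'
  refine lt_of_le_of_lt ?_ hx'
  rw [← (hx.comp tendsto_one_div_add_nhdsGT).limsup_eq]
  refine limsup_le_limsup (Eventually.of_forall fun n => iSup_le fun i => ?_)
  have h1 := (le_abs_self _).trans (h (1 / ((n : ℝ) + 1)) x (w i) 1 (hw i))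
  have hpos : 0 < volume (Metric.closedBall x (1 / ((n : ℝ) + 1))) :=
    Metric.measure_closedBall_pos _ _ Nat.one_div_pos_of_nat
  rw [one_mul] at h1
  refine (ENNReal.ofReal_le_ofReal h1).trans (le_of_eq ?_)
  rw [measureReal_def, measureReal_def, ← ENNReal.toReal_div, ENNReal.ofReal_toReal]
  · rfl
  · exact ENNReal.div_ne_top (measure_ne_top _ _) hpos.ne'

/-- A slice with finite upper norm is continuous for uniform convergence on the cube. -/
lemma ofReal_slice_le_upperNorm {Z : LipChain (k + m) k} {w : ℕ → Form m 0} {x : E k}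
    {T : Current m 0} (hT : IsSlice Z x T)
    (hw : ∀ ψ : Form m 0, (∀ z ∈ cube m, |scalar ψ z| ≤ 1) → ∀ ε > 0, ∃ i, ∀ z ∈ cube m,
      |scalar (w i) z - scalar ψ z| ≤ ε) {χ : Form m 0} (hχ : ∀ z ∈ cube m, |scalar χ z| ≤ 1) :
    ENNReal.ofReal (T χ) ≤ upperNorm Z w x := by
  obtain ⟨κ, hκ, h⟩ := exists_measure_abs_tubeAverage_le Z
  rw [← upperDensity_eq_of_tendsto (hT.tendsto_tubeAverage χ)]
  refine limsup_le_limsup (Eventually.of_forall fun n => ?_)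
  set r := 1 / ((n : ℝ) + 1) with hr
  have hr0 : 0 ≤ r := by positivity
  choose i hi using fun j : ℕ => hw χ hχ (1 / ((j : ℝ) + 1)) Nat.one_div_pos_of_nat
  -- each average is continuous for uniform convergence, the chain being dominated by `κ`
  have hlim : Tendsto (fun j => tubeAverage Z r x (w (i j))) atTop (𝓝 (tubeAverage Z r x χ)) := by
    rw [tendsto_iff_dist_tendsto_zero]
    have h0 := tendsto_one_div_add_atTop_nhds_zero_nat.mul_const
      (κ.real (Metric.closedBall x r) / volume.real (Metric.closedBall x r))
    rw [zero_mul] at h0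
    refine squeeze_zero (fun _ => dist_nonneg) (fun j => ?_) h0
    have h1 : tubeAverage Z r x (w (i j)) - tubeAverage Z r x χ =
        tubeAverage Z r x (w (i j) + (-1 : ℝ) • χ) := by
      simp only [tubeAverage]
      rw [integral_tubeForm_add_smul Z _ _ _ hr0]
      ring
    rw [Real.dist_eq, h1]
    refine h r x _ _ fun z hz => ?_
    have h2 : scalar (w (i j) + (-1 : ℝ) • χ) z = scalar (w (i j)) z - scalar χ z := by
      change scalar (w (i j)) z + (-1) * scalar χ z = _
      ring
    rw [h2]
    exact hi j z hz
  exact le_of_tendsto' (ENNReal.tendsto_ofReal hlim) fun j =>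
    le_iSup (fun i => ENNReal.ofReal (tubeAverage Z r x (w i))) (i j)

/-- Where the upper norm is finite, the filling volume of the slice is computed by a dense
sequence of calibrating functions. -/
lemma FV_slice_le {Z : LipChain (k + m) k} {u w : ℕ → Form m 0} {x : E k}
    (hu : ∀ ψ : Form m 0, VanishesOnBoundary ψ → comass (d m 0 ψ) ≤ 1 → ∀ ε > 0,
      ∃ i, ∀ z ∈ cube m, |scalar (u i) z - scalar ψ z| ≤ ε)
    (hw : ∀ ψ : Form m 0, (∀ z ∈ cube m, |scalar ψ z| ≤ 1) → ∀ ε > 0, ∃ i, ∀ z ∈ cube m,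
      |scalar (w i) z - scalar ψ z| ≤ ε) (hfin : upperNorm Z w x ≠ ∞) :
    FV (slice Z x) ≤ ⨆ i, upperDensity Z (u i) x := by
  by_cases hex : ∃ T, IsSlice Z x T
  swap
  · rw [slice, dif_neg hex, FV_zero]
    exact bot_le
  obtain ⟨T, hT⟩ := hex
  rw [hT.slice_eq]
  refine FV_le_of_forall_ofReal_le T _ fun ψ hψ hd => ?_
  set b := (upperNorm Z w x).toReal
  have hlim : Tendsto (fun j : ℕ => (⨆ i, upperDensity Z (u i) x) +
      ENNReal.ofReal (1 / ((j : ℝ) + 1) * b)) atTop (𝓝 (⨆ i, upperDensity Z (u i) x)) := by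
    have := ENNReal.tendsto_ofReal (tendsto_one_div_add_atTop_nhds_zero_nat.mul_const b)
    rw [zero_mul, ENNReal.ofReal_zero] at this
    simpa using tendsto_const_nhds.add this
  refine ge_of_tendsto' hlim fun j => ?_
  set ε := 1 / ((j : ℝ) + 1) with hε
  have hε0 : 0 < ε := Nat.one_div_pos_of_nat
  obtain ⟨i, hi⟩ := hu ψ hψ hd ε hε0
  have h1 : T (ε⁻¹ • (ψ + (-1 : ℝ) • u i)) ≤ b := by
    rw [← ENNReal.ofReal_le_iff_le_toReal hfin]
    refine ofReal_slice_le_upperNorm hT hw fun z hz => ?_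
    change |ε⁻¹ * (scalar ψ z + (-1) * scalar (u i) z)| ≤ 1
    rw [abs_mul, abs_of_pos (inv_pos.2 hε0), inv_mul_le_iff₀ hε0, mul_one, neg_one_mul,
      ← sub_eq_add_neg, abs_sub_comm]
    exact hi z hz
  rw [map_smul, map_add, map_smul, smul_eq_mul, smul_eq_mul, inv_mul_le_iff₀ hε0] at h1
  calc ENNReal.ofReal (T ψ) ≤ ENNReal.ofReal (T (u i) + ε * b) :=
        ENNReal.ofReal_le_ofReal (by linarith)
    _ ≤ ENNReal.ofReal (T (u i)) + ENNReal.ofReal (ε * b) := ENNReal.ofReal_add_le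
    _ ≤ _ := by
        rw [← upperDensity_eq_of_tendsto (hT.tendsto_tubeAverage (u i))]
        exact add_le_add (le_iSup (fun i => upperDensity Z (u i) x) i) le_rfl

end Slice

end CubeCycles

theorem mainTheorem8 {Ω : Type*} [MeasurableSpace Ω] (P : Measure Ω) [IsProbabilityMeasure P]
    (k m : ℕ) (Z : Ω → CubeCycles.LipChain (k + m) k) (hZ : CubeCycles.IsRandomLipCycle Z)
    (p : CubeCycles.E k → ℝ) (hp_nonneg : ∀ x ∈ CubeCycles.cube k, 0 ≤ p x)
    (hp_int : IntegrableOn p (CubeCycles.cube k))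
    (hp : ∀ᵐ x ∂(volume.restrict (CubeCycles.cube k)),
      ENNReal.ofReal (p x) ≤ ∫⁻ s, CubeCycles.FV (CubeCycles.slice (Z s) x) ∂P) :
    ENNReal.ofReal (∫ x in CubeCycles.cube k, p x) ≤
      ∫⁻ s, CubeCycles.FV (CubeCycles.LipChain.toCurrent (Z s)) ∂P := by
  obtain ⟨u, hu, hu'⟩ := CubeCycles.exists_seq_dense_on_cube (m := m)
    (V := {ψ | CubeCycles.VanishesOnBoundary ψ ∧ CubeCycles.comass (CubeCycles.d m 0 ψ) ≤ 1})
    ⟨0, (CubeCycles.relForm m 0).zero_mem, by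
      rw [map_zero, CubeCycles.comass_zero]
      exact zero_le_one⟩
  obtain ⟨w, hw, hw'⟩ := CubeCycles.exists_seq_dense_on_cube (m := m)
    (V := {ψ | ∀ z ∈ CubeCycles.cube m, |CubeCycles.scalar ψ z| ≤ 1})
    ⟨0, fun z _ => by
      change |(0 : ℝ)| ≤ 1
      simp⟩
  have hmeas : ∀ ψ (n : ℕ), Measurable fun q : CubeCycles.E k × Ω =>
      ENNReal.ofReal (CubeCycles.tubeAverage (Z q.2) (1 / ((n : ℝ) + 1)) q.1 ψ) := fun ψ n =>
    (CubeCycles.measurable_tubeAverage hZ.measurable (by positivity) ψ).ennreal_ofReal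
  have hgm : Measurable fun q : CubeCycles.E k × Ω =>
      ⨆ i, CubeCycles.upperDensity (Z q.2) (u i) q.1 :=
    Measurable.iSup fun i => Measurable.limsup fun n => hmeas (u i) n
  have hbm : Measurable fun q : CubeCycles.E k × Ω => CubeCycles.upperNorm (Z q.2) w q.1 :=
    Measurable.limsup fun n => Measurable.iSup fun i => hmeas (w i) n
  -- a jointly measurable majorant of the filling volume of the slices, valid everywhere
  let G : CubeCycles.E k → Ω → ℝ≥0∞ := fun x s =>
    (⨆ i, CubeCycles.upperDensity (Z s) (u i) x) +
      ({∞} : Set ℝ≥0∞).indicator (fun _ => ∞) (CubeCycles.upperNorm (Z s) w x)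
  have hGm : Measurable (Function.uncurry G) :=
    hgm.add ((measurable_const.indicator (measurableSet_singleton _)).comp hbm)
  have hG : ∀ x s, CubeCycles.FV (CubeCycles.slice (Z s) x) ≤ G x s := by
    intro x s
    by_cases hfin : CubeCycles.upperNorm (Z s) w x = ∞
    · simp [G, hfin]
    · exact (CubeCycles.FV_slice_le (fun ψ h1 h2 => hu' ψ ⟨h1, h2⟩) hw' hfin).trans le_self_add
  have hG' : ∀ s, ∫⁻ x, G x s ≤ CubeCycles.FV (CubeCycles.LipChain.toCurrent (Z s)) := by
    intro s
    refine le_trans (le_of_eq (lintegral_congr_ae ?_))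
      (CubeCycles.lintegral_iSup_upperDensity_le_FV (Z s) hu)
    filter_upwards [CubeCycles.ae_upperNorm_lt_top (Z s) hw] with x hx
    simp [G, hx.ne]
  calc ENNReal.ofReal (∫ x in CubeCycles.cube k, p x)
      = ∫⁻ x in CubeCycles.cube k, ENNReal.ofReal (p x) :=
        ofReal_integral_eq_lintegral_ofReal hp_int
          ((ae_restrict_iff' (CubeCycles.isCompact_cube k).measurableSet).2
            (Eventually.of_forall hp_nonneg))
    _ ≤ ∫⁻ x in CubeCycles.cube k, ∫⁻ s, G x s ∂P :=
        lintegral_mono_ae (hp.mono fun x hx => hx.trans (lintegral_mono (hG x)))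
    _ = ∫⁻ s, (∫⁻ x in CubeCycles.cube k, G x s) ∂P := lintegral_lintegral_swap hGm.aemeasurable
    _ ≤ ∫⁻ s, CubeCycles.FV (CubeCycles.LipChain.toCurrent (Z s)) ∂P :=
        lintegral_mono fun s => (setLIntegral_le_lintegral _ _).trans (hG' s)
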